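/- **Theorem.** An *identification* of two distinct vertices $u,v$ of a graph replaces $u$ and $v$ by a single new vertex that is adjacent to every other vertex that is a neighbor of $u$ or of $v$. In the problem Clique-Identification, the input is a finite simple graph $G$ on $n$ vertices and an integer $k\ge 0$, and the question is whether $G$ can be transformed into a complete graph by at most $k$ identifications. This problem is solvable in $k^{\mathcal{O}(k)}\cdot n^{\mathcal{O}(1)}$ time. Precisely: there are a single random access machine program (unit cost, with addition, truncated subtraction and comparison of natural numbers as its arithmetic, and the input graph given by its adjacency matrix) and a constant $c$ such that, on every input $(G,k)$, the program halts after at most $c\cdot k^{ck}\cdot (n+1)^{c}$ steps (where $0^0=1$) and correctly answers whether $(G,k)$ is a yes-instance. -/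

import Mathlib

/-! ### Vertex identifications -/

/-- The graph obtained from `G` by identifying `u` and `v` (used for `u ≠ v`): both vertices are
replaced with one vertex adjacent to all the other vertices that are neighbours of `u` or of `v`.
The vertex `v` is removed and `u` takes the role of the new vertex. -/
def SimpleGraph.identify {V : Type*} (G : SimpleGraph V) (u v : V) :
    SimpleGraph {x : V // x ≠ v} where
  Adj x y := x ≠ y ∧
    (G.Adj x y ∨ ((x : V) = u ∧ G.Adj v y) ∨ ((y : V) = u ∧ G.Adj v x))
  symm := ⟨by
    rintro x y ⟨hne, h | h | h⟩
    · exact ⟨hne.symm, Or.inl h.symm⟩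
    · exact ⟨hne.symm, Or.inr (Or.inr h)⟩
    · exact ⟨hne.symm, Or.inr (Or.inl h)⟩⟩
  loopless := ⟨fun _ h => h.1 rfl⟩

/-- `G.IdentifiesTo H j`: the graph `G` is transformed into (an isomorphic copy of) `H` by a
sequence of exactly `j` identifications, each of two distinct vertices of the current graph. -/
inductive SimpleGraph.IdentifiesTo {W : Type} (H : SimpleGraph W) :
    {V : Type} → SimpleGraph V → ℕ → Prop
  | iso {V : Type} {G : SimpleGraph V} (e : G ≃g H) : SimpleGraph.IdentifiesTo H G 0
  | step {V : Type} {G : SimpleGraph V} {u v : V} {j : ℕ} (huv : u ≠ v)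
      (h : SimpleGraph.IdentifiesTo H (G.identify u v) j) : SimpleGraph.IdentifiesTo H G (j + 1)

/-- `(G, k)` is a yes-instance of the identification problem for the graph class `C`: at most `k`
identifications transform `G` into some member of `C`. -/
def ClassIdentification (C : ∀ {W : Type}, SimpleGraph W → Prop)
    {V : Type} (G : SimpleGraph V) (k : ℕ) : Prop :=
  ∃ j ≤ k, ∃ (W : Type) (H : SimpleGraph W), C H ∧ SimpleGraph.IdentifiesTo H G j

/-- The class of complete graphs: any two distinct vertices are adjacent. -/
def IsCompleteGraph {W : Type} (H : SimpleGraph W) : Prop :=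
  ∀ x y : W, x ≠ y → H.Adj x y

/-- Clique-Identification: the identification problem for the class of complete graphs. -/
def CliqueIdentification {V : Type} (G : SimpleGraph V) (k : ℕ) : Prop :=
  ClassIdentification IsCompleteGraph G k

/-! ### Random access machines

A random access machine has registers and arrays, all of whose cells hold natural numbers. Its
program is finite, so it names finitely many registers and arrays. The only arithmetic is addition,
truncated subtraction and comparison (no multiplication), and every operation costs one step; this
unit-cost model is polynomially equivalent to Turing machines. -/

namespace RAM

/-- The memory: `reg x` is the content of register `x`, and `arr a i` is the content of cell `i` of
array `a`. -/
structure Store where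
  reg : ℕ → ℕ
  arr : ℕ → ℕ → ℕ

/-- Write `m` into register `x`. -/
def Store.setReg (s : Store) (x m : ℕ) : Store :=
  { s with reg := Function.update s.reg x m }

/-- Write `m` into cell `i` of array `a`. -/
def Store.setArr (s : Store) (a i m : ℕ) : Store :=
  { s with arr := Function.update s.arr a (Function.update (s.arr a) i m) }

/-- Expressions: constants, registers, array cells `a[e]`, sum, truncated difference, and the test
`e < f` (with value `1` or `0`). -/
inductive Expr
  | lit (m : ℕ)
  | reg (x : ℕ)
  | arr (a : ℕ) (e : Expr)
  | add (e f : Expr)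
  | sub (e f : Expr)
  | lt (e f : Expr)

/-- The value of an expression. -/
def Expr.eval (s : Store) : Expr → ℕ
  | lit m => m
  | reg x => s.reg x
  | arr a e => s.arr a (e.eval s)
  | add e f => e.eval s + f.eval s
  | sub e f => e.eval s - f.eval s
  | lt e f => if e.eval s < f.eval s then 1 else 0

/-- The number of steps needed to evaluate an expression: one for each of its operations. -/
def Expr.cost : Expr → ℕ
  | lit _ => 1
  | reg _ => 1
  | arr _ e => e.cost + 1
  | add e f => e.cost + f.cost + 1
  | sub e f => e.cost + f.cost + 1
  | lt e f => e.cost + f.cost + 1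

/-- Programs. A test `e` succeeds if its value is nonzero. -/
inductive Prog
  | skip
  | assign (x : ℕ) (e : Expr)
  | store (a : ℕ) (i e : Expr)
  | seq (p q : Prog)
  | cond (e : Expr) (p q : Prog)
  | loop (e : Expr) (p : Prog)

/-- `Exec p s t s'`: started in `s`, the program `p` halts in `s'` after exactly `t` steps. -/
inductive Exec : Prog → Store → ℕ → Store → Prop
  | skip (s : Store) : Exec Prog.skip s 1 s
  | assign (x : ℕ) (e : Expr) (s : Store) :
      Exec (Prog.assign x e) s (e.cost + 1) (s.setReg x (e.eval s))
  | store (a : ℕ) (i e : Expr) (s : Store) :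
      Exec (Prog.store a i e) s (i.cost + e.cost + 1) (s.setArr a (i.eval s) (e.eval s))
  | seq {p q : Prog} {s s' s'' : Store} {t t' : ℕ} (hp : Exec p s t s') (hq : Exec q s' t' s'') :
      Exec (Prog.seq p q) s (t + t') s''
  | cond_true {e : Expr} {p q : Prog} {s s' : Store} {t : ℕ} (he : e.eval s ≠ 0)
      (hp : Exec p s t s') : Exec (Prog.cond e p q) s (e.cost + 1 + t) s'
  | cond_false {e : Expr} {p q : Prog} {s s' : Store} {t : ℕ} (he : e.eval s = 0)
      (hq : Exec q s t s') : Exec (Prog.cond e p q) s (e.cost + 1 + t) s'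
  | loop_true {e : Expr} {p : Prog} {s s' s'' : Store} {t t' : ℕ} (he : e.eval s ≠ 0)
      (hp : Exec p s t s') (hl : Exec (Prog.loop e p) s' t' s'') :
      Exec (Prog.loop e p) s (e.cost + 1 + t + t') s''
  | loop_false {e : Expr} {p : Prog} {s : Store} (he : e.eval s = 0) :
      Exec (Prog.loop e p) s (e.cost + 1) s

/-- The machine is deterministic: the running time and the final memory are unique. -/
theorem Exec.det {p : Prog} {s s₁ s₂ : Store} {t₁ t₂ : ℕ}
    (h₁ : Exec p s t₁ s₁) (h₂ : Exec p s t₂ s₂) : t₁ = t₂ ∧ s₁ = s₂ := by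
  induction h₁ generalizing t₂ s₂ with
  | skip s => cases h₂; exact ⟨rfl, rfl⟩
  | assign x e s => cases h₂; exact ⟨rfl, rfl⟩
  | store a i e s => cases h₂; exact ⟨rfl, rfl⟩
  | seq hp hq ihp ihq =>
    cases h₂ with
    | seq hp' hq' =>
      obtain ⟨rfl, rfl⟩ := ihp hp'
      obtain ⟨rfl, rfl⟩ := ihq hq'
      exact ⟨rfl, rfl⟩
  | cond_true he hp ih =>
    cases h₂ with
    | cond_true he' hp' => obtain ⟨rfl, rfl⟩ := ih hp'; exact ⟨rfl, rfl⟩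
    | cond_false he' hq' => exact absurd he' he
  | cond_false he hq ih =>
    cases h₂ with
    | cond_true he' hp' => exact absurd he he'
    | cond_false he' hq' => obtain ⟨rfl, rfl⟩ := ih hq'; exact ⟨rfl, rfl⟩
  | loop_true he hp hl ihp ihl =>
    cases h₂ with
    | loop_true he' hp' hl' =>
      obtain ⟨rfl, rfl⟩ := ihp hp'
      obtain ⟨rfl, rfl⟩ := ihl hl'
      exact ⟨rfl, rfl⟩
    | loop_false he' => exact absurd he' he
  | loop_false he =>
    cases h₂ with
    | loop_true he' hp' hl' => exact absurd he he'
    | loop_false he' => exact ⟨rfl, rfl⟩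

open scoped Classical in
/-- The initial memory on the instance `(G, k)`, where `G` has the vertices `0, …, n - 1`: register
`0` holds `n`, register `1` holds `k`, array `0` holds the adjacency matrix of `G` row by row (cell
`i * n + j` is `1` if `i` and `j` are adjacent and `0` otherwise), and all the rest is `0`. -/
noncomputable def input {n : ℕ} (G : SimpleGraph (Fin n)) (k : ℕ) : Store where
  reg x := if x = 0 then n else if x = 1 then k else 0
  arr a m :=
    if a = 0 ∧ ∃ i j : Fin n, m = (i : ℕ) * n + (j : ℕ) ∧ G.Adj i j then 1 else 0

open scoped Classical in
/-- On every instance `(G, k)` of the problem `Q`, where `G` has `n` vertices, the program `p` halts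
after at most `T n k` steps, leaving the answer in register `0` (`1` for yes and `0` for no). -/
def Prog.DecidesInTime (p : Prog) (Q : ∀ {n : ℕ}, SimpleGraph (Fin n) → ℕ → Prop)
    (T : ℕ → ℕ → ℕ) : Prop :=
  ∀ (n : ℕ) (G : SimpleGraph (Fin n)) (k : ℕ), ∃ (t : ℕ) (s : Store),
    Exec p (input G k) t s ∧ t ≤ T n k ∧ s.reg 0 = if Q G k then 1 else 0

end RAM

/-! Identifications merge vertices into the fibres of a surjection. So a yes-instance is a partition
of the vertices into at least `n - k` parts, any two joined by an edge (`cliqueIdentification_iff`).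
At most `2k` vertices lie in parts with several vertices. The set `S` of these vertices is a vertex
cover of the complement, since two nonadjacent vertices cannot both be parts on their own.

Let `C` be the vertex set of a greedy maximal matching in the complement. Outside `C` the graph is a
clique. Every matched pair meets `S`, so `|C| ≤ 2|C ∩ S|` and `|S ∪ C| ≤ 2|S| ≤ 4k = L`. The parts
meeting `S ∪ C` are named by colours from `1` to `2L`, those up to `L` being kept for parts inside
`C` (`exists_isSol`).

A colouring is built in `L` rounds: a fixed rule picks the vertex, a word supplies its colour. The
vertices of `C` come first. After that the parts inside `C` are known, and an uncoloured vertex with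
no neighbour in one of them cannot be a part on its own, so it is picked next. If there is no such
vertex, the uncoloured vertices are interchangeable: each is adjacent to all parts inside `C`, and
two parts that both leave `C` are joined by an edge of the clique (`IsSol.swap`). Hence some word
reproduces a solution (`IsSol.exists_word`), while every accepted colouring is a solution by itself.

There are `(2L + 1) ^ L = (8k + 1) ^ (4k)` words, each handled in polynomial time. On the machine,
the searches and tests are terms with bounded sums, compiled with polynomial cost (`Tm.wp_comp`,
`Tm.exists_cost_le`), and a counter in base `8k + 1` enumerates the words (`wp_nextWord`). -/

namespace RAM

/-! ### Weakest preconditions with a time bound -/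

/-- Started in `s`, the program `p` halts within `T` steps in a store satisfying `Q`. -/
def WP (p : Prog) (T : ℕ) (s : Store) (Q : Store → Prop) : Prop :=
  ∃ t s', Exec p s t s' ∧ t ≤ T ∧ Q s'

theorem WP.mono {p : Prog} {T T' : ℕ} {s : Store} {Q Q' : Store → Prop}
    (h : WP p T s Q) (hT : T ≤ T') (hQ : ∀ s', Q s' → Q' s') : WP p T' s Q' := by
  obtain ⟨t, s', he, ht, hq⟩ := h
  exact ⟨t, s', he, ht.trans hT, hQ _ hq⟩

theorem WP.skip {s : Store} {Q : Store → Prop} (h : Q s) : WP Prog.skip 1 s Q :=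
  ⟨_, _, Exec.skip s, le_rfl, h⟩

theorem WP.assign {x : ℕ} {e : Expr} {s : Store} {Q : Store → Prop}
    (h : Q (s.setReg x (e.eval s))) : WP (Prog.assign x e) (e.cost + 1) s Q :=
  ⟨_, _, Exec.assign x e s, le_rfl, h⟩

theorem WP.store {a : ℕ} {i e : Expr} {s : Store} {Q : Store → Prop}
    (h : Q (s.setArr a (i.eval s) (e.eval s))) :
    WP (Prog.store a i e) (i.cost + e.cost + 1) s Q :=
  ⟨_, _, Exec.store a i e s, le_rfl, h⟩

theorem WP.seq {p q : Prog} {T T' : ℕ} {s : Store} {Q : Store → Prop}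
    (h : WP p T s fun s' => WP q T' s' Q) : WP (Prog.seq p q) (T + T') s Q := by
  obtain ⟨t, s', he, ht, t', s'', he', ht', hq⟩ := h
  exact ⟨_, _, Exec.seq he he', Nat.add_le_add ht ht', hq⟩

theorem WP.cond {e : Expr} {p q : Prog} {T : ℕ} {s : Store} {Q : Store → Prop}
    (h₁ : e.eval s ≠ 0 → WP p T s Q) (h₂ : e.eval s = 0 → WP q T s Q) :
    WP (Prog.cond e p q) (e.cost + 1 + T) s Q := by
  by_cases he : e.eval s = 0
  · obtain ⟨t, s', hx, ht, hq⟩ := h₂ he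
    exact ⟨_, _, Exec.cond_false he hx, by omega, hq⟩
  · obtain ⟨t, s', hx, ht, hq⟩ := h₁ he
    exact ⟨_, _, Exec.cond_true he hx, by omega, hq⟩

/-- A loop that runs exactly `N` times, with an invariant indexed by the number of rounds done. -/
theorem WP.loop {e : Expr} {p : Prog} {T : ℕ} (I : ℕ → Store → Prop) (N : ℕ)
    (hstep : ∀ i < N, ∀ s, I i s → e.eval s ≠ 0 ∧ WP p T s (I (i + 1)))
    (hend : ∀ s, I N s → e.eval s = 0) {s : Store} (h0 : I 0 s) :
    WP (Prog.loop e p) (N * (e.cost + 1 + T) + (e.cost + 1)) s (I N) := by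
  suffices H : ∀ m i, i + m = N → ∀ s, I i s →
      WP (Prog.loop e p) (m * (e.cost + 1 + T) + (e.cost + 1)) s (I N) from
    H N 0 (by omega) s h0
  intro m
  induction m with
  | zero =>
    rintro i rfl s hi
    exact ⟨_, _, Exec.loop_false (hend s hi), by omega, hi⟩
  | succ m ih =>
    intro i hi s hs
    obtain ⟨he, t, s', hx, ht, hq⟩ := hstep i (by omega) s hs
    obtain ⟨t', s'', hx', ht', hq'⟩ := ih (i + 1) (by omega) s' hq
    refine ⟨_, _, Exec.loop_true he hx hx', ?_, hq'⟩
    rw [Nat.succ_mul]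
    omega

@[simp] theorem Store.setReg_reg (s : Store) (x m y : ℕ) :
    (s.setReg x m).reg y = if y = x then m else s.reg y := by
  simp [Store.setReg, Function.update_apply]

@[simp] theorem Store.setReg_arr (s : Store) (x m : ℕ) : (s.setReg x m).arr = s.arr := rfl

@[simp] theorem Store.setArr_reg (s : Store) (a i m : ℕ) : (s.setArr a i m).reg = s.reg := rfl

@[simp] theorem Store.setArr_arr (s : Store) (a i m b : ℕ) :
    (s.setArr a i m).arr b = if b = a then Function.update (s.arr a) i m else s.arr b := by
  simp only [Store.setArr, Function.update_apply]

/-- The two stores have the same arrays and the same registers below `d`. -/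
structure Store.Agree (d : ℕ) (s s' : Store) : Prop where
  reg : ∀ x < d, s'.reg x = s.reg x
  arr : s'.arr = s.arr

/-! ### Terms with bounded sums -/

/-- Terms: expressions extended by sums `∑ x < n`, where `n` is the content of register `0`. -/
inductive Tm
  | lit (m : ℕ)
  | reg (x : ℕ)
  | arr (a : ℕ) (t : Tm)
  | add (t u : Tm)
  | lt (t u : Tm)
  | sum (x : ℕ) (t : Tm)

namespace Tm

/-- The value of a term. -/
def eval : Tm → Store → ℕ
  | lit m, _ => m
  | reg x, s => s.reg x
  | arr a t, s => s.arr a (t.eval s)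
  | add t u, s => t.eval s + u.eval s
  | lt t u, s => if t.eval s < u.eval s then 1 else 0
  | sum x t, s => ∑ i ∈ Finset.range (s.reg 0), t.eval (s.setReg x i)

/-- All registers of the term are below `d`, and register `0` is not a summation variable. -/
def Below (d : ℕ) : Tm → Prop
  | lit _ => True
  | reg x => x < d
  | arr _ t => t.Below d
  | add t u => t.Below d ∧ u.Below d
  | lt t u => t.Below d ∧ u.Below d
  | sum x t => (0 < x ∧ x < d) ∧ t.Below d

theorem Below.mono {d d' : ℕ} (hd : d ≤ d') : ∀ {t : Tm}, t.Below d → t.Below d'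
  | lit _, _ => trivial
  | reg _, h => lt_of_lt_of_le h hd
  | arr _ t, h => Below.mono (t := t) hd h
  | add _ _, h => ⟨h.1.mono hd, h.2.mono hd⟩
  | lt _ _, h => ⟨h.1.mono hd, h.2.mono hd⟩
  | sum _ _, h => ⟨⟨h.1.1, h.1.2.trans_le hd⟩, h.2.mono hd⟩

theorem eval_congr {d : ℕ} (hd : 0 < d) {t : Tm} (ht : t.Below d) {s s' : Store}
    (h : s.Agree d s') : t.eval s' = t.eval s := by
  induction t generalizing s s' with
  | lit m => rfl
  | reg x => exact h.reg x ht
  | arr a t ih => simp only [eval, ih ht h, h.arr]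
  | add t u iht ihu => simp only [eval, iht ht.1 h, ihu ht.2 h]
  | lt t u iht ihu => simp only [eval, iht ht.1 h, ihu ht.2 h]
  | sum x t ih =>
    simp only [eval, h.reg 0 hd]
    refine Finset.sum_congr rfl fun i _ => ih ht.2 ⟨fun y hy => ?_, h.arr⟩
    simp [h.reg y hy]

/-- The compiled term: it leaves the value in register `d` and changes no register below `d`. -/
def comp : ℕ → Tm → Prog
  | d, lit m => .assign d (.lit m)
  | d, reg x => .assign d (.reg x)
  | d, arr a t => .seq (comp d t) (.assign d (.arr a (.reg d)))
  | d, add t u => .seq (comp d t) (.seq (comp (d + 1) u) (.assign d (.add (.reg d) (.reg (d + 1)))))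
  | d, lt t u => .seq (comp d t) (.seq (comp (d + 1) u) (.assign d (.lt (.reg d) (.reg (d + 1)))))
  | d, sum x t =>
    -- Register `d + 1` saves the old content of `x` for the final restoration, `d` accumulates the
    -- sum, and each summand is computed in `d + 2`.
    .seq (.assign (d + 1) (.reg x)) <| .seq (.assign d (.lit 0)) <| .seq (.assign x (.lit 0)) <|
      .seq (.loop (.lt (.reg x) (.reg 0)) <|
        .seq (comp (d + 2) t) <| .seq (.assign d (.add (.reg d) (.reg (d + 2)))) <|
          .assign x (.add (.reg x) (.lit 1))) <|
      .assign x (.reg (d + 1))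

/-- A bound on the running time of the compiled term. -/
def cost (n : ℕ) : Tm → ℕ
  | lit _ => 2
  | reg _ => 2
  | arr _ t => t.cost n + 3
  | add t u => t.cost n + (u.cost n + 4)
  | lt t u => t.cost n + (u.cost n + 4)
  | sum _ t => 2 + (2 + (2 + ((n * (4 + (t.cost n + (4 + 4))) + 4) + 2)))

theorem wp_comp (t : Tm) (d : ℕ) (hd : 0 < d) (ht : t.Below d) (s : Store) :
    WP (comp d t) (t.cost (s.reg 0)) s fun s' => s.Agree d s' ∧ s'.reg d = t.eval s := by
  induction t generalizing d s with
  | lit m =>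
    exact WP.assign ⟨⟨fun x hx => by simp [hx.ne], rfl⟩, by simp [eval, Expr.eval]⟩
  | reg x =>
    exact WP.assign ⟨⟨fun x hx => by simp [hx.ne], rfl⟩, by simp [eval, Expr.eval]⟩
  | arr a t ih =>
    refine WP.seq ((ih d hd ht s).mono le_rfl fun s₁ h₁ => WP.assign ⟨⟨fun x hx => ?_, ?_⟩, ?_⟩)
    · simp [hx.ne, h₁.1.reg x hx]
    · simp [h₁.1.arr]
    · simp [eval, Expr.eval, h₁.1.arr, h₁.2]
  | add t u iht ihu =>
    refine WP.seq ((iht d hd ht.1 s).mono le_rfl fun s₁ h₁ => WP.seq <|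
      (ihu (d + 1) (by omega) (ht.2.mono (by omega)) s₁).mono (by rw [h₁.1.reg 0 hd]) fun s₂ h₂ =>
        WP.assign ⟨⟨fun x hx => ?_, ?_⟩, ?_⟩)
    · simp [hx.ne, h₂.1.reg x (by omega), h₁.1.reg x hx]
    · simp [h₂.1.arr, h₁.1.arr]
    · simp [eval, Expr.eval, h₂.2, h₂.1.reg d (by omega), h₁.2, eval_congr hd ht.2 h₁.1]
  | lt t u iht ihu =>
    refine WP.seq ((iht d hd ht.1 s).mono le_rfl fun s₁ h₁ => WP.seq <|
      (ihu (d + 1) (by omega) (ht.2.mono (by omega)) s₁).mono (by rw [h₁.1.reg 0 hd]) fun s₂ h₂ =>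
        WP.assign ⟨⟨fun x hx => ?_, ?_⟩, ?_⟩)
    · simp [hx.ne, h₂.1.reg x (by omega), h₁.1.reg x hx]
    · simp [h₂.1.arr, h₁.1.arr]
    · simp [eval, Expr.eval, h₂.2, h₂.1.reg d (by omega), h₁.2, eval_congr hd ht.2 h₁.1]
  | sum x t ih =>
    obtain ⟨⟨hx0, hxd⟩, ht⟩ := ht
    refine WP.seq (WP.assign (WP.seq (WP.assign (WP.seq (WP.assign (WP.seq ?_))))))
    -- The comparison is with `s.setReg x i` and not with `s`: the summation register holds the
    -- round number until the last assignment restores it.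
    refine (WP.loop (T := t.cost (s.reg 0) + (4 + 4)) (fun i s' =>
      (s.setReg x i).Agree d s' ∧ s'.reg (d + 1) = s.reg x ∧
        s'.reg d = ∑ j ∈ Finset.range i, t.eval (s.setReg x j)) (s.reg 0) ?_ ?_ ?_).mono le_rfl ?_
    · rintro i hi s₁ ⟨ha, h1, h2⟩
      have h0 : s₁.reg 0 = s.reg 0 := by simpa [hx0.ne] using ha.reg 0 hd
      have hx : s₁.reg x = i := by simpa using ha.reg x hxd
      refine ⟨by simp [Expr.eval, h0, hx, hi], WP.seq ?_⟩
      refine (ih (d + 2) (by omega) (ht.mono (by omega)) s₁).mono (by rw [h0]) fun s₂ h₂ =>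
        WP.seq (WP.assign (WP.assign ⟨⟨fun y hy => ?_, ?_⟩, ?_, ?_⟩))
      · have := ha.reg y hy
        by_cases hyx : y = x
        · subst hyx
          simp [Expr.eval, hxd.ne, h₂.1.reg y (by omega), hx]
        · simpa [hyx, Expr.eval, hy.ne, h₂.1.reg y (by omega)] using this
      · simp [h₂.1.arr, ha.arr]
      · simp [Expr.eval, h₂.1.reg (d + 1) (by omega), h1, show d + 1 ≠ x by omega]
      · simp [Expr.eval, h₂.1.reg d (by omega), h2, hxd.ne', h₂.2, Finset.sum_range_succ,
          eval_congr hd ht ha]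
    · rintro s₁ ⟨ha, h1, h2⟩
      have h0 : s₁.reg 0 = s.reg 0 := by simpa [hx0.ne] using ha.reg 0 hd
      have hx : s₁.reg x = s.reg 0 := by simpa using ha.reg x hxd
      simp [Expr.eval, h0, hx]
    · refine ⟨⟨fun y hy => ?_, by simp⟩, ?_, ?_⟩
      · simp [Expr.eval, hy.ne, show y ≠ d + 1 by omega]
      · simp [Expr.eval, show d + 1 ≠ x by omega]
      · simp [Expr.eval, hxd.ne']
    · rintro s₁ ⟨ha, h1, h2⟩
      refine WP.assign ⟨⟨fun y hy => ?_, ha.arr⟩, ?_⟩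
      · have := ha.reg y hy
        by_cases hyx : y = x
        · simp [hyx, Expr.eval, h1]
        · simpa [hyx] using this
      · simp [eval, h2, hxd.ne']

/-! #### Derived terms; a term stands for the proposition that its value is nonzero -/

/-- The proposition that a term stands for. -/
def Holds (t : Tm) (s : Store) : Prop := t.eval s ≠ 0

/-- Negation. -/
def not (t : Tm) : Tm := lt t (lit 1)

/-- Conjunction. -/
def and (t u : Tm) : Tm := not (add (not t) (not u))

/-- Disjunction. -/
def or (t u : Tm) : Tm := add t u

/-- Equality. -/
def eq (t u : Tm) : Tm := not (add (lt t u) (lt u t))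

/-- The quantifier `∃ x < n`. -/
def ex (x : ℕ) (t : Tm) : Tm := sum x t

/-- The quantifier `∀ x < n`. -/
def all (x : ℕ) (t : Tm) : Tm := not (ex x (not t))

/-- The number of `x < n` with a property. -/
def count (x : ℕ) (t : Tm) : Tm := sum x (not (not t))

/-- The least `x < n` with a property, or `n` if there is none; `y` is an auxiliary variable. -/
def least (y x : ℕ) (t : Tm) : Tm := count y (all x (or (lt (reg y) (reg x)) (not t)))

/-- The entry `(t, u)` of the `n × n` matrix stored in array `0`; `z` is an auxiliary variable. -/
def entry (z : ℕ) (t u : Tm) : Tm := arr 0 (add (sum z t) u)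

variable {t u : Tm} {s : Store}

@[simp] theorem holds_not : (not t).Holds s ↔ ¬ t.Holds s := by
  simp [Holds, not, eval]

@[simp] theorem holds_or : (or t u).Holds s ↔ t.Holds s ∨ u.Holds s := by
  simp [Holds, or, eval]; tauto

@[simp] theorem holds_and : (and t u).Holds s ↔ t.Holds s ∧ u.Holds s := by
  simp [Holds, and, not, eval]

@[simp] theorem holds_lt : (lt t u).Holds s ↔ t.eval s < u.eval s := by
  simp [Holds, eval]

@[simp] theorem holds_eq : (eq t u).Holds s ↔ t.eval s = u.eval s := by
  simp [Holds, eq, not, eval]; omega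

@[simp] theorem holds_ex {x : ℕ} :
    (ex x t).Holds s ↔ ∃ i < s.reg 0, t.Holds (s.setReg x i) := by
  simp [Holds, ex, eval]

@[simp] theorem holds_all {x : ℕ} :
    (all x t).Holds s ↔ ∀ i < s.reg 0, t.Holds (s.setReg x i) := by
  simp [all]

open scoped Classical in
theorem eval_count {x : ℕ} :
    (count x t).eval s =
      ((Finset.range (s.reg 0)).filter fun i => t.Holds (s.setReg x i)).card := by
  simp only [count, eval, Finset.card_filter]
  refine Finset.sum_congr rfl fun i _ => ?_
  by_cases h : t.Holds (s.setReg x i)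
  · rw [if_pos h]; simp [Holds] at h; simp [not, eval, h]
  · rw [if_neg h]; simp [Holds] at h; simp [not, eval, h]

open scoped Classical in
/-- The least `i : Fin n` with `P i`, as a natural number, or `n` if there is none. -/
noncomputable def _root_.leastFin {n : ℕ} (P : Fin n → Prop) : ℕ :=
  if h : ∃ i, ∃ hi : i < n, P ⟨i, hi⟩ then Nat.find h else n

theorem _root_.leastFin_spec {n : ℕ} (P : Fin n → Prop) :
    (∃ h : leastFin P < n, P ⟨leastFin P, h⟩) ∨ (leastFin P = n ∧ ∀ i, ¬ P i) := by
  classical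
  by_cases h : ∃ i, ∃ hi : i < n, P ⟨i, hi⟩
  · left
    rw [leastFin, dif_pos h]
    exact Nat.find_spec h
  · right
    rw [leastFin, dif_neg h]
    push Not at h
    exact ⟨rfl, fun i => h i i.2⟩

/-- The indices `y` such that no index up to `y` has the property are exactly those below the least
one that has it, so their number is this least index. If no index has the property, all `n` are
counted. -/
theorem eval_least {x y n : ℕ} (hy : 0 < y) (hxy : x ≠ y) {P : Fin n → Prop}
    (hn : s.reg 0 = n) (hP : ∀ i (hi : i < n) j, t.Holds ((s.setReg y j).setReg x i) ↔ P ⟨i, hi⟩) :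
    (least y x t).eval s = leastFin P := by
  classical
  have he : (least y x t).eval s =
      ((Finset.range n).filter fun j => ∀ i, ∀ hi : i < n, j < i ∨ ¬ P ⟨i, hi⟩).card := by
    rw [least, eval_count, hn]
    congr 1
    refine Finset.filter_congr fun j _ => ?_
    simp only [holds_all, Store.setReg_reg, hy.ne, if_false, hn, holds_or, holds_lt, eval,
      if_true, hxy.symm, holds_not]
    exact forall₂_congr fun i hi => by rw [hP i hi]
  by_cases h : ∃ i, ∃ hi : i < n, P ⟨i, hi⟩
  · have hf : (Finset.range n).filter (fun j => ∀ i, ∀ hi : i < n, j < i ∨ ¬ P ⟨i, hi⟩) =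
        Finset.range (Nat.find h) := by
      ext j
      simp only [Finset.mem_filter, Finset.mem_range, Nat.lt_find_iff]
      constructor
      · rintro ⟨hj, hall⟩ m hm ⟨hmn, hPm⟩
        rcases hall m hmn with h | h
        · omega
        · exact h hPm
      · intro hall
        refine ⟨?_, fun i hi => ?_⟩
        · by_contra hj
          obtain ⟨hlt, hp⟩ := Nat.find_spec h
          exact hall _ (hlt.le.trans (not_lt.1 hj)) ⟨hlt, hp⟩
        · by_contra hc
          push Not at hc
          exact hall i hc.1 ⟨hi, hc.2⟩
    rw [he, hf, Finset.card_range, leastFin, dif_pos h]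
  · rw [leastFin, dif_neg h, he, Finset.filter_true_of_mem, Finset.card_range]
    push Not at h
    exact fun j _ i hi => Or.inr (h i hi)

/-- Assign the value of a term whose registers are below `20` to a register. -/
def set (x : ℕ) (t : Tm) : Prog := .seq (comp 20 t) (.assign x (.reg 20))

theorem wp_set {x : ℕ} (ht : t.Below 20) :
    WP (set x t) (t.cost (s.reg 0) + 2) s fun s' => (s.setReg x (t.eval s)).Agree 20 s' := by
  refine WP.seq ((wp_comp t 20 (by omega) ht s).mono le_rfl fun s₁ h₁ => WP.assign ⟨?_, ?_⟩)
  · intro y hy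
    simp [Expr.eval, h₁.2, h₁.1.reg y hy]
  · simp [h₁.1.arr]

/-- There is no multiplication, so the row offset is a sum of `n` equal summands; this is why `t`
must not depend on `z`. -/
theorem eval_entry {z : ℕ} (ht : ∀ i, t.eval (s.setReg z i) = t.eval s) :
    (entry z t u).eval s = s.arr 0 (t.eval s * s.reg 0 + u.eval s) := by
  simp [entry, eval, ht, mul_comm]

/-- The running time of a compiled term is polynomial. -/
theorem exists_cost_le (t : Tm) : ∃ a, ∀ n, t.cost n ≤ a * (n + 1) ^ a := by
  have key : ∀ a b c : ℕ, a ≤ b → ∀ n, a * (n + 1) ^ a + c ≤ (b + c) * (n + 1) ^ b := by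
    intro a b c hab n
    have h1 : (n + 1) ^ a ≤ (n + 1) ^ b := Nat.pow_le_pow_right (by omega) hab
    have h2 : 1 ≤ (n + 1) ^ b := Nat.one_le_pow _ _ (by omega)
    nlinarith [Nat.mul_le_mul hab h1, Nat.mul_le_mul_left c h2]
  have bin : ∀ t u : Tm, (∃ a, ∀ n, t.cost n ≤ a * (n + 1) ^ a) →
      (∃ a, ∀ n, u.cost n ≤ a * (n + 1) ^ a) →
      ∃ a, ∀ n, t.cost n + (u.cost n + 4) ≤ a * (n + 1) ^ a := by
    rintro t u ⟨a, ha⟩ ⟨b, hb⟩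
    refine ⟨a + b + 4, fun n => ?_⟩
    have h1 : (n + 1) ^ a ≤ (n + 1) ^ (a + b + 4) := Nat.pow_le_pow_right (by omega) (by omega)
    have h2 : (n + 1) ^ b ≤ (n + 1) ^ (a + b + 4) := Nat.pow_le_pow_right (by omega) (by omega)
    have h3 : 1 ≤ (n + 1) ^ (a + b + 4) := Nat.one_le_pow _ _ (by omega)
    nlinarith [ha n, hb n, Nat.mul_le_mul_left a h1, Nat.mul_le_mul_left b h2]
  induction t with
  | lit m => exact ⟨2, fun n => by simpa [cost] using Nat.one_le_pow _ _ (by omega)⟩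
  | reg m => exact ⟨2, fun n => by simpa [cost] using Nat.one_le_pow _ _ (by omega)⟩
  | arr a t ih =>
    obtain ⟨b, hb⟩ := ih
    refine ⟨b + 3, fun n => ?_⟩
    have h1 : (n + 1) ^ b ≤ (n + 1) ^ (b + 3) := Nat.pow_le_pow_right (by omega) (by omega)
    have h3 : 1 ≤ (n + 1) ^ (b + 3) := Nat.one_le_pow _ _ (by omega)
    simp only [cost]
    nlinarith [hb n, Nat.mul_le_mul_left b h1]
  | add t u iht ihu => exact bin t u iht ihu
  | lt t u iht ihu => exact bin t u iht ihu
  | sum x t ih =>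
    obtain ⟨b, hb⟩ := ih
    refine ⟨b + 24, fun n => ?_⟩
    have h1 : (n + 1) ^ (b + 1) ≤ (n + 1) ^ (b + 24) :=
      Nat.pow_le_pow_right (by omega) (by omega)
    have h3 : (n + 1) ^ 1 ≤ (n + 1) ^ (b + 24) := Nat.pow_le_pow_right (by omega) (by omega)
    have h4 : n * t.cost n ≤ b * (n + 1) ^ (b + 1) := by
      calc n * t.cost n ≤ (n + 1) * (b * (n + 1) ^ b) := Nat.mul_le_mul (by omega) (hb n)
        _ = b * (n + 1) ^ (b + 1) := by ring
    simp only [cost]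
    nlinarith [Nat.mul_le_mul_left b h1]

end Tm

end RAM

/-! ### Identifications and complete quotients -/

/-- `f` maps the vertices of `G` onto `W`, and any two fibres of `f` are joined by an edge. -/
structure SimpleGraph.IsCompleteQuotient {V W : Type} (G : SimpleGraph V) (f : V → W) : Prop where
  surjective : Function.Surjective f
  exists_adj : ∀ u v, f u ≠ f v → ∃ u' v', f u' = f u ∧ f v' = f v ∧ G.Adj u' v'

/-- Compose the quotient map of the identified graph with the map `r` that sends `v` to `u`. An edge
at the new vertex comes from an edge at `u` or at `v`, and these two lie in the same fibre. -/
theorem SimpleGraph.IdentifiesTo.exists_quotient {W : Type} {H : SimpleGraph W}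
    (hH : IsCompleteGraph H) {V : Type} {G : SimpleGraph V} {j : ℕ} (h : H.IdentifiesTo G j) :
    Finite V → ∃ f : V → W, G.IsCompleteQuotient f ∧ Nat.card V = Nat.card W + j := by
  induction h with
  | iso e =>
    intro _
    refine ⟨e, ⟨e.surjective, fun u v huv => ⟨u, v, rfl, rfl, ?_⟩⟩, Nat.card_congr e.toEquiv⟩
    exact e.map_adj_iff.1 (hH _ _ huv)
  | @step V G u v j huv h ih =>
    classical
    intro _
    obtain ⟨f, hf, hc⟩ := ih inferInstance
    set r : V → {x : V // x ≠ v} := fun x => if h : x = v then ⟨u, huv⟩ else ⟨x, h⟩ with hr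
    have hrx : ∀ x : {x : V // x ≠ v}, r x = x := fun x => by simp [hr, x.2]
    have hrv : r v = ⟨u, huv⟩ := by simp [hr]
    refine ⟨f ∘ r, ⟨fun w => ?_, fun x y hxy => ?_⟩, ?_⟩
    · obtain ⟨x, rfl⟩ := hf.surjective w
      exact ⟨x, by simp [hrx]⟩
    · obtain ⟨a, b, ha, hb, -, hab | ⟨hau, hab⟩ | ⟨hbu, hab⟩⟩ := hf.exists_adj _ _ hxy
      · exact ⟨a, b, by simp [hrx, ha], by simp [hrx, hb], hab⟩
      · refine ⟨v, b, ?_, by simp [hrx, hb], hab⟩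
        rw [Function.comp_apply, hrv,
          show (⟨u, huv⟩ : {x : V // x ≠ v}) = a from Subtype.ext hau.symm, ha]
        rfl
      · refine ⟨a, v, by simp [hrx, ha], ?_, hab.symm⟩
        rw [Function.comp_apply, hrv,
          show (⟨u, huv⟩ : {x : V // x ≠ v}) = b from Subtype.ext hbu.symm, hb]
        rfl
    · have : Nat.card V = Nat.card {x : V // x ≠ v} + 1 := by
        have := Fintype.ofFinite V
        rw [Nat.card_eq_fintype_card, Nat.card_eq_fintype_card, Fintype.card_subtype_compl]
        simp only [Fintype.card_unique]
        have : 0 < Fintype.card V := Fintype.card_pos_iff.2 ⟨v⟩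
        omega
      omega

/-- As long as `f` is not injective, identify two vertices of one fibre: the restriction of `f` is
again a complete quotient, with one vertex fewer. Once `f` is bijective, the graph itself is
complete. -/
theorem SimpleGraph.IsCompleteQuotient.exists_identifiesTo {W : Type} (j : ℕ) :
    ∀ {V : Type} [Finite V] {G : SimpleGraph V} {f : V → W}, G.IsCompleteQuotient f →
      Nat.card V = Nat.card W + j →
      ∃ (W' : Type) (H : SimpleGraph W'), IsCompleteGraph H ∧ H.IdentifiesTo G j := by
  induction j with
  | zero =>
    intro V _ G f hf hc
    have hfin : Finite W := Finite.of_surjective f hf.surjective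
    have hb : Function.Bijective f :=
      (Nat.bijective_iff_surjective_and_card f).2 ⟨hf.surjective, hc⟩
    refine ⟨V, G, fun x y hxy => ?_, .iso (SimpleGraph.Iso.refl)⟩
    obtain ⟨u, v, hu, hv, h⟩ := hf.exists_adj x y (hb.1.ne hxy)
    rwa [hb.1 hu, hb.1 hv] at h
  | succ j ih =>
    intro V _ G f hf hc
    have hni : ¬ Function.Injective f := fun hi => by
      have := Nat.card_congr (Equiv.ofBijective f ⟨hi, hf.surjective⟩)
      omega
    simp only [Function.Injective, not_forall] at hni
    obtain ⟨u, v, huv, hne⟩ := hni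
    have hcard : Nat.card V = Nat.card {x : V // x ≠ v} + 1 := by
      classical
      have := Fintype.ofFinite V
      rw [Nat.card_eq_fintype_card, Nat.card_eq_fintype_card, Fintype.card_subtype_compl]
      simp only [Fintype.card_unique]
      have : 0 < Fintype.card V := Fintype.card_pos_iff.2 ⟨v⟩
      omega
    have hq : (G.identify u v).IsCompleteQuotient fun x => f x := by
      refine ⟨fun w => ?_, fun x y hxy => ?_⟩
      · obtain ⟨x, rfl⟩ := hf.surjective w
        by_cases hx : x = v
        · exact ⟨⟨u, hne⟩, by rw [hx]; exact huv⟩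
        · exact ⟨⟨x, hx⟩, rfl⟩
      · obtain ⟨a, b, ha, hb, hab⟩ := hf.exists_adj x y hxy
        have hfab : f a ≠ f b := by rwa [ha, hb]
        by_cases hav : a = v
        · have hbv : b ≠ v := fun h => hfab (by rw [hav, h])
          refine ⟨⟨u, hne⟩, ⟨b, hbv⟩, by rw [← ha, hav]; exact huv, hb, ?_, ?_⟩
          · intro h
            exact hfab (by rw [hav, ← huv]; exact congrArg (fun z => f z.1) h)
          · exact Or.inr (Or.inl ⟨rfl, hav ▸ hab⟩)
        · by_cases hbv : b = v
          · refine ⟨⟨a, hav⟩, ⟨u, hne⟩, ha, by rw [← hb, hbv]; exact huv, ?_, ?_⟩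
            · intro h
              exact hfab (by rw [hbv, ← huv]; exact congrArg (fun z => f z.1) h)
            · exact Or.inr (Or.inr ⟨rfl, hbv ▸ hab.symm⟩)
          · exact ⟨⟨a, hav⟩, ⟨b, hbv⟩, ha, hb, fun h => hfab (congrArg (fun z => f z.1) h),
              Or.inl hab⟩
    obtain ⟨W', H, hH, h⟩ := ih hq (by omega)
    exact ⟨W', H, hH, .step hne h⟩

/-- Each identification removes one vertex, so the number of identifications is `Nat.card V -
Nat.card W`. -/
theorem cliqueIdentification_iff {V : Type} [Finite V] {G : SimpleGraph V} {k : ℕ} :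
    CliqueIdentification G k ↔
      ∃ (W : Type) (f : V → W), G.IsCompleteQuotient f ∧ Nat.card V ≤ Nat.card W + k := by
  constructor
  · rintro ⟨j, hj, W, H, hH, h⟩
    obtain ⟨f, hf, hc⟩ := h.exists_quotient hH inferInstance
    exact ⟨W, f, hf, by omega⟩
  · rintro ⟨W, f, hf, hc⟩
    have hle : Nat.card W ≤ Nat.card V := Nat.card_le_card_of_surjective f hf.surjective
    obtain ⟨W', H, hH, h⟩ := hf.exists_identifiesTo (Nat.card V - Nat.card W) (by omega)
    exact ⟨_, by omega, W', H, hH, h⟩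

/-- A finite set splits into the first elements of the fibres of `f` and the other elements. -/
theorem Finset.card_image_add_card_filter_lt {α β : Type*} [LinearOrder α] [DecidableEq β]
    (s : Finset α) (f : α → β) [DecidablePred fun u => ∃ v ∈ s, v < u ∧ f v = f u] :
    (s.image f).card + (s.filter fun u => ∃ v ∈ s, v < u ∧ f v = f u).card = s.card := by
  have h : (s.image f).card = (s.filter fun u => ¬ ∃ v ∈ s, v < u ∧ f v = f u).card := by
    rw [← Finset.card_image_of_injOn (f := f)
      (s := s.filter fun u => ¬ ∃ v ∈ s, v < u ∧ f v = f u)]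
    · congr 1
      ext b
      simp only [Finset.mem_image, Finset.mem_filter]
      constructor
      · rintro ⟨a, ha, rfl⟩
        have hne : (s.filter fun u => f u = f a).Nonempty := ⟨a, by simp [ha]⟩
        have hm := Finset.min'_mem _ hne
        rw [Finset.mem_filter] at hm
        refine ⟨_, ⟨hm.1, ?_⟩, hm.2⟩
        rintro ⟨v, hv, hlt, hfv⟩
        exact absurd (Finset.min'_le (s.filter fun u => f u = f a) v
          (by simp [hv, hfv, hm.2])) (not_le.2 hlt)
      · rintro ⟨a, ⟨ha, -⟩, rfl⟩
        exact ⟨a, ha, rfl⟩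
    · intro a ha b hb hab
      simp only [Finset.coe_filter, Set.mem_ofPred_eq] at ha hb
      rcases lt_trichotomy a b with h | h | h
      · exact absurd ⟨a, ha.1, h, hab⟩ hb.2
      · exact h
      · exact absurd ⟨b, hb.1, h, hab.symm⟩ ha.2
  rw [h, add_comm, Finset.card_filter_add_card_filter_not]

namespace CliqueId

open scoped Classical

variable {n : ℕ}

/-! ### Partitions given by colourings

A colouring `g` with values in `ℕ` stands for the partition whose parts are the classes of the
nonzero colours and the single vertices of colour `0`. -/

/-- The vertices `u` and `v` are in the same part. -/
def Same (g : Fin n → ℕ) (u v : Fin n) : Prop := u = v ∨ (g u ≠ 0 ∧ g u = g v)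

theorem Same.symm {g : Fin n → ℕ} {u v : Fin n} (h : Same g u v) : Same g v u := by
  rcases h with rfl | ⟨h, h'⟩
  · exact Or.inl rfl
  · exact Or.inr ⟨h' ▸ h, h'.symm⟩

theorem Same.trans {g : Fin n → ℕ} {u v w : Fin n} (h : Same g u v) (h' : Same g v w) :
    Same g u w := by
  rcases h with rfl | ⟨h1, h2⟩
  · exact h'
  · rcases h' with rfl | ⟨h3, h4⟩
    · exact Or.inr ⟨h1, h2⟩
    · exact Or.inr ⟨h1, h2.trans h4⟩

/-- Any two parts are joined by an edge. -/
def Complete (G : SimpleGraph (Fin n)) (g : Fin n → ℕ) : Prop :=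
  ∀ u v, Same g u v ∨ ∃ u' v', Same g u u' ∧ Same g v v' ∧ G.Adj u' v'

/-- The partition witnesses a yes-instance. -/
def Accepts (G : SimpleGraph (Fin n)) (k : ℕ) (g : Fin n → ℕ) : Prop :=
  Complete G g ∧ (Finset.univ.filter fun u => ∃ v, v < u ∧ Same g v u).card ≤ k

/-- Soundness: the fibres of `F` are the parts, and the vertices that are not first in their part
number `n` minus the number of parts. -/
theorem Accepts.cliqueIdentification {G : SimpleGraph (Fin n)} {k : ℕ} {g : Fin n → ℕ}
    (h : Accepts G k g) : CliqueIdentification G k := by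
  set F : Fin n → Fin n ⊕ ℕ := fun v => if g v = 0 then .inl v else .inr (g v) with hF
  have hFs : ∀ u v, F u = F v ↔ Same g u v := by
    intro u v
    simp only [hF, Same]
    by_cases hu : g u = 0 <;> by_cases hv : g v = 0 <;> simp [hu, hv]
    · rintro rfl; exact hv hu
    · rintro rfl; exact absurd hv hu
    · rintro rfl; rfl
  refine cliqueIdentification_iff.2 ⟨Set.range F, Set.rangeFactorization F,
    ⟨Set.rangeFactorization_surjective, fun u v huv => ?_⟩, ?_⟩
  · rcases h.1 u v with hs | ⟨u', v', hu, hv, hadj⟩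
    · exact absurd (Subtype.ext ((hFs u v).2 hs)) huv
    · exact ⟨u', v', Subtype.ext ((hFs _ _).2 hu.symm), Subtype.ext ((hFs _ _).2 hv.symm), hadj⟩
  · have hc : Nat.card (Set.range F) = (Finset.univ.image F).card := by
      rw [← Set.ncard_coe_finset, Finset.coe_image, Finset.coe_univ, Set.image_univ]
      rfl
    have := Finset.card_image_add_card_filter_lt Finset.univ F
    have h2 := h.2
    simp only [Finset.mem_univ, true_and, hFs, Finset.card_univ, Fintype.card_fin] at this
    rw [hc, Nat.card_fin]
    omega

/-! ### Vertex covers of the complement and solutions in normal form -/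

/-- The set `C` has at most twice as many vertices as it shares with any vertex cover of the
complement of `G`. -/
def HalfCovered (G : SimpleGraph (Fin n)) (C : Finset (Fin n)) : Prop :=
  ∀ S : Finset (Fin n), (∀ u v, u ≠ v → ¬ G.Adj u v → u ∈ S ∨ v ∈ S) →
    C.card ≤ 2 * (C ∩ S).card

/-- The set grows by two vertices, and every vertex cover of the complement contains at least one of
the nonadjacent `x` and `y`. -/
theorem HalfCovered.insert_insert {G : SimpleGraph (Fin n)} {C : Finset (Fin n)}
    (h : HalfCovered G C) {x y : Fin n} (hx : x ∉ C) (hy : y ∉ C) (hxy : x ≠ y) (hadj : ¬ G.Adj x y) :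
    HalfCovered G (insert x (insert y C)) := by
  intro S hS
  have h1 := h S hS
  have h2 : (insert x (insert y C)).card = C.card + 2 := by
    rw [Finset.card_insert_of_notMem (by simp [hx, hxy]), Finset.card_insert_of_notMem hy]
  have h3 : (C ∩ S).card + 1 ≤ (insert x (insert y C) ∩ S).card := by
    rcases hS x y hxy hadj with hs | hs
    · rw [← Finset.card_insert_of_notMem (a := x) (s := C ∩ S) (by simp [hx])]
      refine Finset.card_le_card fun z hz => ?_
      simp only [Finset.mem_insert, Finset.mem_inter] at hz ⊢
      rcases hz with rfl | hz
      · exact ⟨Or.inl rfl, hs⟩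
      · exact ⟨Or.inr (Or.inr hz.1), hz.2⟩
    · rw [← Finset.card_insert_of_notMem (a := y) (s := C ∩ S) (by simp [hy])]
      refine Finset.card_le_card fun z hz => ?_
      simp only [Finset.mem_insert, Finset.mem_inter] at hz ⊢
      rcases hz with rfl | hz
      · exact ⟨Or.inr (Or.inl rfl), hs⟩
      · exact ⟨Or.inr (Or.inr hz.1), hz.2⟩
  omega

/-- A solution in which the vertices of `C` and those of the parts with several vertices have a
nonzero colour, which is at most `L` exactly for the parts inside `C`. -/
structure IsSol (G : SimpleGraph (Fin n)) (C : Finset (Fin n)) (k L : ℕ) (g : Fin n → ℕ) :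
    Prop where
  complete : Complete G g
  card_le : (Finset.univ.filter fun v => g v ≠ 0).card ≤
    k + ((Finset.univ.filter fun v => g v ≠ 0).image g).card
  ne_zero : ∀ v ∈ C, g v ≠ 0
  supp_le : (Finset.univ.filter fun v => g v ≠ 0).card ≤ L
  open_of_notMem : ∀ v ∉ C, g v ≠ 0 → L < g v
  exists_notMem : ∀ c, L < g c → ∃ v ∉ C, g v = g c
  le : ∀ v, g v ≤ 2 * L

/-- A vertex that is not first in its part is coloured, and the coloured vertices that are not first
in their class number the coloured vertices minus the colours used. -/
theorem IsSol.accepts {G : SimpleGraph (Fin n)} {C : Finset (Fin n)} {k L : ℕ} {g : Fin n → ℕ}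
    (h : IsSol G C k L g) : Accepts G k g := by
  refine ⟨h.complete, ?_⟩
  have h1 := Finset.card_image_add_card_filter_lt (Finset.univ.filter fun v => g v ≠ 0) g
  have h2 := h.card_le
  refine le_trans (Finset.card_le_card (t := (Finset.univ.filter fun v => g v ≠ 0).filter
    fun u => ∃ v ∈ Finset.univ.filter fun v => g v ≠ 0, v < u ∧ g v = g u) fun u hu => ?_)
    (by omega)
  simp only [Finset.mem_filter, Finset.mem_univ, true_and] at hu ⊢
  obtain ⟨v, hvu, rfl | ⟨h0, hg⟩⟩ := hu
  · exact absurd hvu (lt_irrefl _)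
  · exact ⟨hg ▸ h0, v, h0, hvu, hg⟩

/-- A yes-instance has a solution of the special form. -/
theorem exists_isSol {G : SimpleGraph (Fin n)} {C : Finset (Fin n)} {k : ℕ}
    (hC : HalfCovered G C) (h : CliqueIdentification G k) : ∃ g, IsSol G C k (4 * k) g := by
  obtain ⟨W, f, hf, hc⟩ := cliqueIdentification_iff.1 h
  have hWfin : Finite W := Finite.of_surjective f hf.surjective
  set N := Finset.univ.filter fun u => ∃ v ∈ (Finset.univ : Finset (Fin n)), v < u ∧ f v = f u
    with hN
  have hNk : N.card ≤ k := by
    have h1 : (Finset.univ.image f).card + N.card = (Finset.univ : Finset (Fin n)).card := by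
      rw [hN]
      convert Finset.card_image_add_card_filter_lt (Finset.univ : Finset (Fin n)) f
    have h2 : (Finset.univ.image f).card = Nat.card W := by
      have := Fintype.ofFinite W
      rw [Finset.image_univ_of_surjective hf.surjective, Nat.card_eq_fintype_card,
        Finset.card_univ]
    rw [Finset.card_univ, Fintype.card_fin] at h1
    rw [Nat.card_fin] at hc
    omega
  set S := Finset.univ.filter fun v => ∃ u, u ≠ v ∧ f u = f v with hS
  -- `S \ N` consists of the first vertices of the fibres with several elements. Each such fibre
  -- also has an element in `N`, so `S \ N` is no larger than `N`.
  have hSk : S.card ≤ 2 * k := by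
    have h1 : (S \ N).card ≤ N.card := by
      rw [← Finset.card_image_of_injOn (f := f) (s := S \ N)]
      · refine (Finset.card_le_card fun w hw => ?_).trans (Finset.card_image_le (f := f))
        obtain ⟨v, hv, rfl⟩ := Finset.mem_image.1 hw
        simp only [hS, hN, Finset.mem_sdiff, Finset.mem_filter, Finset.mem_univ, true_and] at hv
        obtain ⟨⟨u, huv, hfu⟩, hv⟩ := hv
        refine Finset.mem_image.2 ⟨u, ?_, hfu⟩
        simp only [hN, Finset.mem_filter, Finset.mem_univ, true_and]
        refine ⟨v, lt_of_le_of_ne (not_lt.1 fun hlt => hv ⟨u, hlt, hfu⟩) huv.symm, hfu.symm⟩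
      · intro a ha b hb hab
        simp only [hN, Finset.coe_sdiff, Finset.coe_filter, Finset.mem_univ, true_and,
          Set.mem_sdiff, Set.mem_ofPred_eq] at ha hb
        rcases lt_trichotomy a b with h | h | h
        · exact absurd ⟨a, h, hab⟩ hb.2
        · exact h
        · exact absurd ⟨b, h, hab.symm⟩ ha.2
    have h2 := Finset.card_le_card (s := S) (t := S \ N ∪ N) (by
      intro x hx
      by_cases hxN : x ∈ N <;> simp [hx, hxN])
    have h3 := Finset.card_union_le (S \ N) N
    omega
  have hsingle : ∀ u v, u ∉ S → f v = f u → v = u := by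
    intro u v hu huv
    by_contra hne
    exact hu (by simp only [hS, Finset.mem_filter, Finset.mem_univ, true_and]; exact ⟨v, hne, huv⟩)
  have hcov : ∀ u v, u ≠ v → ¬ G.Adj u v → u ∈ S ∨ v ∈ S := by
    intro u v huv hadj
    by_contra hcon
    push Not at hcon
    obtain ⟨u', v', hu', hv', ha⟩ := hf.exists_adj u v fun h => huv (hsingle v u hcon.2 h)
    rw [hsingle u u' hcon.1 hu', hsingle v v' hcon.2 hv'] at ha
    exact hadj ha
  set T := S ∪ C with hT
  -- `|S ∪ C| = |S| + |C| - |S ∩ C| ≤ |S| + |S ∩ C| ≤ 2|S|`; this is the source of `L = 4 * k`.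
  have hTL : T.card ≤ 4 * k := by
    have h1 := hC S hcov
    have h2 : T.card + (S ∩ C).card = S.card + C.card := Finset.card_union_add_card_inter S C
    have h3 : (S ∩ C).card ≤ S.card := Finset.card_le_card Finset.inter_subset_left
    rw [Finset.inter_comm C S] at h1
    omega
  obtain ⟨r, hrinj, hrlt⟩ : ∃ r : W → ℕ, Set.InjOn r (T.image f) ∧
      ∀ w ∈ T.image f, r w < 4 * k := by
    set e := (T.image f).equivFin
    refine ⟨fun w => if h : w ∈ T.image f then (e ⟨w, h⟩ : ℕ) else 0, ?_, ?_⟩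
    · intro a ha b hb hab
      rw [Finset.mem_coe] at ha hb
      simp only [ha, hb, dif_pos] at hab
      simpa using e.injective (Fin.ext hab)
    · intro w hw
      simp only [hw, dif_pos]
      exact (e ⟨w, hw⟩).2.trans_le (Finset.card_image_le.trans hTL)
  -- As `r` takes values below `4 * k`, parts inside `C` get colours from `1` to `L`, the others
  -- from `L + 1` to `2 * L`, and `0` stays free for uncoloured vertices.
  set l : W → ℕ := fun w => if ∀ c, f c = w → c ∈ C then 1 + r w else 1 + 4 * k + r w with hl
  have hlinj : Set.InjOn l (T.image f) := by
    intro a ha b hb hab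
    have h1 := hrlt a ha
    have h2 := hrlt b hb
    refine hrinj ha hb ?_
    simp only [hl] at hab
    split_ifs at hab <;> omega
  have hl0 : ∀ w, l w ≠ 0 := fun w => by simp only [hl]; split_ifs <;> omega
  set g : Fin n → ℕ := fun v => if v ∈ T then l (f v) else 0 with hg
  have hgT : ∀ v, g v ≠ 0 ↔ v ∈ T := fun v => by
    by_cases hv : v ∈ T <;> simp [hg, hv, hl0]
  have hmem : ∀ {v}, v ∈ T → f v ∈ T.image f := fun hv => Finset.mem_image_of_mem f hv
  have hclass : ∀ u v, u ∈ T → f v = f u → g v = g u := by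
    intro u v hu hfv
    by_cases huv : v = u
    · rw [huv]
    · have hv : v ∈ T := Finset.mem_union_left _ (by
        simp only [hS, Finset.mem_filter, Finset.mem_univ, true_and]
        exact ⟨u, fun h => huv h.symm, hfv.symm⟩)
      simp only [hg, hu, hv, if_true, hfv]
  have hsame : ∀ u v, Same g u v ↔ f u = f v := by
    intro u v
    constructor
    · rintro (rfl | ⟨h0, he⟩)
      · rfl
      · have hu := (hgT u).1 h0
        have hv := (hgT v).1 (he ▸ h0)
        simp only [hg, hu, hv, if_true] at he
        exact hlinj (hmem hu) (hmem hv) he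
    · intro he
      by_cases hu : u ∈ T
      · exact Or.inr ⟨(hgT u).2 hu, (hclass u v hu he.symm).symm⟩
      · exact Or.inl (hsingle u v (fun h => hu (Finset.mem_union_left _ h)) he.symm).symm
  have hsupp : (Finset.univ.filter fun v => g v ≠ 0) = T := by
    ext v; simp [hgT]
  refine ⟨g, ?_, ?_, ?_, ?_, ?_, ?_, ?_⟩
  · intro u v
    by_cases huv : f u = f v
    · exact Or.inl ((hsame u v).2 huv)
    · obtain ⟨u', v', hu, hv, ha⟩ := hf.exists_adj u v huv
      exact Or.inr ⟨u', v', (hsame _ _).2 hu.symm, (hsame _ _).2 hv.symm, ha⟩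
  · rw [hsupp]
    have h1 : T.image g = (T.image f).image l := by
      rw [Finset.image_image]
      exact Finset.image_congr fun v hv => by
        rw [Finset.mem_coe] at hv; simp only [hg, hv, if_true, Function.comp_apply]
    rw [h1, Finset.card_image_of_injOn hlinj]
    have h2 := Finset.card_image_add_card_filter_lt T f
    have h3 : (T.filter fun u => ∃ v ∈ T, v < u ∧ f v = f u).card ≤ N.card := by
      refine Finset.card_le_card fun u hu => ?_
      simp only [hN, Finset.mem_filter, Finset.mem_univ, true_and] at hu ⊢
      obtain ⟨-, v, -, h⟩ := hu
      exact ⟨v, h⟩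
    omega
  · exact fun v hv => (hgT v).2 (Finset.mem_union_right _ hv)
  · rwa [hsupp]
  · intro v hv h0
    have hvT := (hgT v).1 h0
    simp only [hg, hvT, if_true, hl]
    rw [if_neg fun h => hv (h v rfl)]
    omega
  · intro c hcL
    have hcT : c ∈ T := (hgT c).1 (by omega)
    have hr := hrlt _ (hmem hcT)
    simp only [hg, hcT, if_true, hl] at hcL
    split_ifs at hcL with hcl
    · omega
    · push Not at hcl
      obtain ⟨v, hv, hvC⟩ := hcl
      exact ⟨v, hvC, hclass c v hcT hv⟩
  · intro v
    by_cases hv : v ∈ T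
    · have hr := hrlt _ (hmem hv)
      simp only [hg, hv, if_true, hl]
      split_ifs <;> omega
    · simp [hg, hv]

/-! ### One round of the branching -/

/-- The vertex `v` has no neighbour in some part whose colour is at most `L`. -/
def Bad (G : SimpleGraph (Fin n)) (L : ℕ) (col : Fin n → ℕ) (v : Fin n) : Prop :=
  ∃ c, (0 < col c ∧ col c ≤ L) ∧ ∀ c', col c' = col c → ¬ G.Adj c' v

/-- The vertex `v` may be coloured next. -/
def Pickable (G : SimpleGraph (Fin n)) (C : Finset (Fin n)) (L : ℕ) (col : Fin n → ℕ)
    (v : Fin n) : Prop :=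
  col v = 0 ∧ (v ∈ C ∨ (∀ c ∈ C, col c ≠ 0) ∧
    (Bad G L col v ∨ ∀ w, col w = 0 → ¬ Bad G L col w))

/-- The coloured vertices have the colours that they have in `g`. -/
def Extends (g col : Fin n → ℕ) : Prop := ∀ v, col v ≠ 0 → col v = g v

/-- Exchanging two uncoloured vertices outside `C` that have neighbours in all parts inside `C`. -/
theorem IsSol.swap {G : SimpleGraph (Fin n)} {C : Finset (Fin n)} {k L : ℕ} {g col : Fin n → ℕ}
    (hg : IsSol G C k L g) (hclique : ∀ u ∉ C, ∀ v ∉ C, u ≠ v → G.Adj u v)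
    (hext : Extends g col) (hcol : ∀ c ∈ C, col c ≠ 0) (hbad : ∀ w, col w = 0 → ¬ Bad G L col w)
    {u v : Fin n} (hu : col u = 0) (hv : col v = 0) (hgv : g v = 0) :
    IsSol G C k L (g ∘ Equiv.swap u v) ∧ Extends (g ∘ Equiv.swap u v) col := by
  have huC : u ∉ C := fun h => hcol u h hu
  have hvC : v ∉ C := fun h => hcol v h hv
  set σ := Equiv.swap u v with hσ
  have hσ' : ∀ w, w ≠ u → w ≠ v → σ w = w := fun w h1 h2 => Equiv.swap_apply_of_ne_of_ne h1 h2
  have hσC : ∀ c ∈ C, σ c = c := fun c hc =>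
    hσ' c (fun h => huC (h ▸ hc)) (fun h => hvC (h ▸ hc))
  have hσnC : ∀ c, c ∉ C → σ c ∉ C := by
    intro c hc h
    have := hσC _ h
    rw [hσ, Equiv.swap_apply_self] at this
    rw [← hσ] at this
    exact hc (this ▸ h)
  have hσσ : ∀ w, σ (σ w) = w := fun w => Equiv.swap_apply_self u v w
  have hsupp : (Finset.univ.filter fun w => (g ∘ σ) w ≠ 0) =
      (Finset.univ.filter fun w => g w ≠ 0).image σ := by
    ext w
    simp only [Finset.mem_filter, Finset.mem_univ, true_and, Finset.mem_image, Function.comp_apply]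
    exact ⟨fun h => ⟨σ w, h, hσσ w⟩, by rintro ⟨x, hx, rfl⟩; rwa [hσσ]⟩
  have hscard : (Finset.univ.filter fun w => (g ∘ σ) w ≠ 0).card =
      (Finset.univ.filter fun w => g w ≠ 0).card := by
    rw [hsupp, Finset.card_image_of_injective _ σ.injective]
  have hopen : ∀ w ∉ C, (g ∘ σ) w ≠ 0 → L < (g ∘ σ) w := fun w hw h0 =>
    hg.open_of_notMem _ (hσnC w hw) h0
  have hexists : ∀ c, L < (g ∘ σ) c → ∃ w ∉ C, (g ∘ σ) w = (g ∘ σ) c := by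
    intro c hc
    obtain ⟨w, hw, h⟩ := hg.exists_notMem _ hc
    exact ⟨σ w, hσnC w hw, by simpa [hσσ] using h⟩
  -- a part inside `C` is joined to every other part
  have key : ∀ x y, ¬ Same (g ∘ σ) x y → (∀ z, Same (g ∘ σ) x z → z ∈ C) →
      ∃ x' y', Same (g ∘ σ) x x' ∧ Same (g ∘ σ) y y' ∧ G.Adj x' y' := by
    intro x y hxy hx
    have hxC : x ∈ C := hx x (Or.inl rfl)
    have hgx : (g ∘ σ) x = g x := by simp [hσC x hxC]
    have hgx0 := hg.ne_zero x hxC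
    have hgxL : g x ≤ L := by
      by_contra hlt
      obtain ⟨w, hw, hgw⟩ := hexists x (by rw [hgx]; omega)
      exact hw (hx w (Or.inr ⟨by rwa [hgx], hgw.symm⟩))
    have hclosed : ∀ z, g z = g x → z ∈ C := by
      intro z hz
      by_contra hzC
      exact absurd (hg.open_of_notMem z hzC (by rwa [hz])) (by omega)
    -- If the part of `y` contains `u` or `v`, that vertex is uncoloured and not bad, which gives
    -- the edge. Otherwise the part is the same for `g` and for `g ∘ σ`, and the old edge still
    -- serves.
    by_cases hy : Same (g ∘ σ) y u ∨ Same (g ∘ σ) y v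
    · obtain ⟨w, hw0, hyw⟩ : ∃ w, col w = 0 ∧ Same (g ∘ σ) y w := by
        rcases hy with h | h
        · exact ⟨u, hu, h⟩
        · exact ⟨v, hv, h⟩
      have hnb := hbad w hw0
      simp only [Bad, not_exists, not_and, not_forall, not_not] at hnb
      have hcx : col x = g x := hext x (hcol x hxC)
      obtain ⟨c', hc', ha⟩ := hnb x ⟨by omega, by omega⟩
      refine ⟨c', w, Or.inr ⟨by rwa [hgx], ?_⟩, hyw, ha⟩
      have hgc' : g c' = g x := by rw [← hext c' (by omega), hc', hcx]
      rw [hgx, Function.comp_apply, hσC c' (hclosed c' hgc'), hgc']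
    · push Not at hy
      have hyu : y ≠ u := fun h => hy.1 (Or.inl h)
      have hyv : y ≠ v := fun h => hy.2 (Or.inl h)
      have hgy : (g ∘ σ) y = g y := by simp [hσ' y hyu hyv]
      rcases hg.complete x y with hs | ⟨x', y', hx', hy', ha⟩
      · refine absurd ?_ hxy
        rcases hs with rfl | ⟨h1, h2⟩
        · exact Or.inl rfl
        · exact Or.inr ⟨by rwa [hgx], by rw [hgx, hgy, h2]⟩
      · refine ⟨x', y', ?_, ?_, ha⟩
        · rcases hx' with rfl | ⟨h1, h2⟩
          · exact Or.inl rfl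
          · exact Or.inr ⟨by rwa [hgx], by
              rw [hgx, Function.comp_apply, hσC x' (hclosed x' h2.symm), h2]⟩
        · rcases hy' with rfl | ⟨h1, h2⟩
          · exact Or.inl rfl
          · have hy'v : y' ≠ v := fun h => h1 (by rw [h2, h, hgv])
            have hy'u : y' ≠ u := fun h => hy.2 (Or.inr ⟨by rwa [hgy], by
              rw [hgy, h2, h, Function.comp_apply, hσ, Equiv.swap_apply_right]⟩)
            exact Or.inr ⟨by rwa [hgy], by rw [hgy, Function.comp_apply, hσ' y' hy'u hy'v, h2]⟩
  refine ⟨⟨?_, ?_, ?_, ?_, hopen, hexists, fun w => hg.le _⟩, ?_⟩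
  · intro x y
    by_cases hxy : Same (g ∘ σ) x y
    · exact Or.inl hxy
    right
    by_cases hx : ∀ z, Same (g ∘ σ) x z → z ∈ C
    · exact key x y hxy hx
    by_cases hy : ∀ z, Same (g ∘ σ) y z → z ∈ C
    · obtain ⟨y', x', h1, h2, h3⟩ := key y x (fun h => hxy h.symm) hy
      exact ⟨x', y', h2, h1, h3.symm⟩
    -- Two parts that both leave `C` are joined by an edge of the clique outside `C`.
    · push Not at hx hy
      obtain ⟨a, hxa, ha⟩ := hx
      obtain ⟨b, hyb, hb⟩ := hy
      refine ⟨a, b, hxa, hyb, hclique a ha b hb ?_⟩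
      rintro rfl
      exact hxy (hxa.trans hyb.symm)
  · rw [hscard]
    have : (Finset.univ.filter fun w => (g ∘ σ) w ≠ 0).image (g ∘ σ) =
        (Finset.univ.filter fun w => g w ≠ 0).image g := by
      rw [hsupp, Finset.image_image]
      exact Finset.image_congr fun w _ => by simp [hσσ]
    rw [this]
    exact hg.card_le
  · intro w hw
    rw [Function.comp_apply, hσC w hw]
    exact hg.ne_zero w hw
  · rw [hscard]
    exact hg.supp_le
  · intro w hw
    rw [Function.comp_apply, hσ' w (fun h => hw (h ▸ hu)) (fun h => hw (h ▸ hv))]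
    exact hext w hw

/-- Some solution that extends the current colouring colours the next vertex. -/
theorem IsSol.exists_round {G : SimpleGraph (Fin n)} {C : Finset (Fin n)} {k L : ℕ}
    {g col : Fin n → ℕ} (hg : IsSol G C k L g)
    (hclique : ∀ u ∉ C, ∀ v ∉ C, u ≠ v → G.Adj u v) (hext : Extends g col) (hne : col ≠ g)
    {v : Fin n} (hv : Pickable G C L col v) :
    ∃ g', IsSol G C k L g' ∧ Extends g' col ∧ g' v ≠ 0 := by
  by_cases hgv : g v = 0
  swap
  · exact ⟨g, hg, hext, hgv⟩
  obtain ⟨hv0, hvC | ⟨hcol, hb | hb⟩⟩ := hv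
  · exact absurd hgv (hg.ne_zero v hvC)
  -- With `g v = 0` the vertex `v` would be a part on its own. A part with colour at most `L` lies
  -- inside `C`, which is completely coloured, so `col` already shows that whole part and `v` has no
  -- neighbour in it.
  · exfalso
    obtain ⟨c, ⟨hc0, hcL⟩, hc⟩ := hb
    have hgc : col c = g c := hext c (by omega)
    rcases hg.complete c v with (rfl | ⟨h1, h2⟩) | ⟨c', v', hc', hv', ha⟩
    · omega
    · omega
    · have hv'v : v' = v := by
        rcases hv' with rfl | ⟨h, -⟩
        · rfl
        · exact absurd hgv h
      subst hv'v
      refine hc c' ?_ ha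
      rcases hc' with rfl | ⟨h1, h2⟩
      · rfl
      · have hc'C : c' ∈ C := by
          by_contra hcon
          exact absurd (hg.open_of_notMem c' hcon (by omega)) (by omega)
        rw [hext c' (hcol c' hc'C), hgc, h2]
  -- The vertex `u` is coloured by `g` but not yet by `col`; exchanging it with `v` gives a solution
  -- that colours `v`.
  · obtain ⟨u, hu⟩ : ∃ u, col u ≠ g u := Function.ne_iff.1 hne
    have hu0 : col u = 0 := by
      by_contra h
      exact hu (hext u h)
    obtain ⟨h1, h2⟩ := hg.swap hclique hext hcol hb hu0 hv0 hgv
    refine ⟨_, h1, h2, ?_⟩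
    rw [Function.comp_apply, Equiv.swap_apply_right]
    exact fun h => hu (by rw [hu0, h])

/-! ### The colouring determined by a word -/

/-- The vertex coloured next, or `n` if all vertices are coloured. -/
noncomputable def pick (G : SimpleGraph (Fin n)) (C : Finset (Fin n)) (L : ℕ)
    (col : Fin n → ℕ) : ℕ :=
  if leastFin (fun v => col v = 0 ∧ v ∈ C) < n then leastFin (fun v => col v = 0 ∧ v ∈ C)
  else if leastFin (fun v => col v = 0 ∧ Bad G L col v) < n then
    leastFin (fun v => col v = 0 ∧ Bad G L col v)
  else leastFin (fun v => col v = 0)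

/-- The failure of each search provides the side condition under which the next one yields a
`Pickable` vertex. -/
theorem pick_spec (G : SimpleGraph (Fin n)) (C : Finset (Fin n)) (L : ℕ) (col : Fin n → ℕ) :
    (∃ h : pick G C L col < n, Pickable G C L col ⟨_, h⟩) ∨
      (pick G C L col = n ∧ ∀ v, col v ≠ 0) := by
  rcases leastFin_spec (fun v => col v = 0 ∧ v ∈ C) with ⟨h1, h1'⟩ | ⟨h1, h1'⟩
  · have : pick G C L col = leastFin (fun v => col v = 0 ∧ v ∈ C) := if_pos h1
    simp only [this]
    exact Or.inl ⟨h1, h1'.1, Or.inl h1'.2⟩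
  have hC : ∀ c ∈ C, col c ≠ 0 := fun c hc h => h1' c ⟨h, hc⟩
  rcases leastFin_spec (fun v => col v = 0 ∧ Bad G L col v) with ⟨h2, h2'⟩ | ⟨h2, h2'⟩
  · have : pick G C L col = leastFin (fun v => col v = 0 ∧ Bad G L col v) := by
      rw [pick, if_neg (by omega), if_pos h2]
    simp only [this]
    exact Or.inl ⟨h2, h2'.1, Or.inr ⟨hC, Or.inl h2'.2⟩⟩
  have : pick G C L col = leastFin (fun v => col v = 0) := by
    rw [pick, if_neg (by omega), if_neg (by omega)]
  simp only [this]
  rcases leastFin_spec (fun v => col v = 0) with ⟨h3, h3'⟩ | ⟨h3, h3'⟩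
  · exact Or.inl ⟨h3, h3', Or.inr ⟨hC, Or.inr fun w hw hb => h2' w ⟨hw, hb⟩⟩⟩
  · exact Or.inr ⟨h3, h3'⟩

/-- Give the vertex with number `v` (if there is one) the colour `d`. -/
def setColor (col : Fin n → ℕ) (v d : ℕ) : Fin n → ℕ := fun u => if (u : ℕ) = v then d else col u

/-- The colouring after `j` rounds, if the colours are read from the word `w`. -/
noncomputable def run (G : SimpleGraph (Fin n)) (C : Finset (Fin n)) (L : ℕ) (w : ℕ → ℕ) :
    ℕ → Fin n → ℕ
  | 0 => fun _ => 0
  | j + 1 => setColor (run G C L w j) (pick G C L (run G C L w j)) (w j)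

theorem run_congr {G : SimpleGraph (Fin n)} {C : Finset (Fin n)} {L : ℕ} {w w' : ℕ → ℕ} (j : ℕ)
    (h : ∀ i < j, w i = w' i) : run G C L w j = run G C L w' j := by
  induction j with
  | zero => rfl
  | succ j ih => simp only [run, ih fun i hi => h i (by omega), h j (by omega)]

/-- Some word leads to an accepted colouring if there is a solution. -/
theorem IsSol.exists_word {G : SimpleGraph (Fin n)} {C : Finset (Fin n)} {k L : ℕ}
    {g₀ : Fin n → ℕ} (hg₀ : IsSol G C k L g₀)
    (hclique : ∀ u ∉ C, ∀ v ∉ C, u ≠ v → G.Adj u v) :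
    ∃ w : ℕ → ℕ, (∀ j, w j ≤ 2 * L) ∧ Accepts G k (run G C L w L) := by
  -- The solution `g` may change from round to round through exchanges. Until the colouring agrees
  -- with it, each round colours a new vertex.
  have H : ∀ j, ∃ w : ℕ → ℕ, (∀ j, w j ≤ 2 * L) ∧ ∃ g, IsSol G C k L g ∧
      Extends g (run G C L w j) ∧ (run G C L w j = g ∨
        j ≤ (Finset.univ.filter fun v => run G C L w j v ≠ 0).card) := by
    intro j
    induction j with
    | zero =>
      exact ⟨fun _ => 0, fun _ => Nat.zero_le _, g₀, hg₀, fun v hv => absurd rfl hv,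
        Or.inr (Nat.zero_le _)⟩
    | succ j ih =>
      obtain ⟨w, hw, g, hg, hext, hj⟩ := ih
      have hrun : ∀ d, run G C L (Function.update w j d) (j + 1) =
          setColor (run G C L w j) (pick G C L (run G C L w j)) d := by
        intro d
        have : run G C L (Function.update w j d) j = run G C L w j :=
          run_congr j fun i hi => by simp [hi.ne]
        simp only [run, this, Function.update_self]
      have hle : ∀ d ≤ 2 * L, ∀ i, Function.update w j d i ≤ 2 * L := by
        intro d hd i
        rw [Function.update_apply]
        split_ifs
        · exact hd
        · exact hw i
      set col := run G C L w j
      by_cases hcol : col = g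
      -- Once the solution is reached, colour `0` makes the remaining rounds idle: the picked
      -- vertex, if any, has colour `0` already.
      · have hsame : setColor col (pick G C L col) 0 = col := by
          funext u
          simp only [setColor]
          split_ifs with hu
          · rcases pick_spec G C L col with ⟨h, hp⟩ | ⟨h, -⟩
            · rw [show u = ⟨_, h⟩ from Fin.ext hu]
              exact hp.1.symm
            · exact absurd u.2 (by omega)
          · rfl
        refine ⟨Function.update w j 0, hle 0 (Nat.zero_le _), g, hg, ?_⟩
        rw [hrun, hsame]
        exact ⟨hext, Or.inl hcol⟩
      · have hj' := hj.resolve_left hcol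
        rcases pick_spec G C L col with ⟨h, hp⟩ | ⟨-, hall⟩
        · obtain ⟨g', hg', hext', hne⟩ := hg.exists_round hclique hext hcol hp
          refine ⟨Function.update w j (g' ⟨_, h⟩), hle _ (hg'.le _), g', hg', ?_⟩
          rw [hrun]
          refine ⟨fun u hu => ?_, Or.inr ?_⟩
          · simp only [setColor] at hu ⊢
            split_ifs with huv
            · rw [show u = ⟨_, h⟩ from Fin.ext huv]
            · rw [if_neg huv] at hu
              exact hext' u hu
          · refine (Nat.succ_le_succ hj').trans ?_
            rw [Nat.succ_eq_add_one, ← Finset.card_insert_of_notMem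
              (a := ⟨_, h⟩) (s := Finset.univ.filter fun v => col v ≠ 0) (by simpa using hp.1)]
            refine Finset.card_le_card fun u hu => Finset.mem_filter.2 ⟨Finset.mem_univ _, ?_⟩
            simp only [Finset.mem_insert, Finset.mem_filter, Finset.mem_univ, true_and] at hu
            simp only [setColor]
            split_ifs with huv
            · exact hne
            · exact hu.resolve_left fun h => huv (congrArg Fin.val h)
        · exact absurd (funext fun v => hext v (hall v)) hcol
  obtain ⟨w, hw, g, hg, hext, hL⟩ := H L
  refine ⟨w, hw, ?_⟩
  have : run G C L w L = g := by
    rcases hL with h | h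
    · exact h
    -- At least `L` vertices are coloured and `g` colours at most `L`, so none is missing.
    · have hs : (Finset.univ.filter fun v => run G C L w L v ≠ 0) =
          Finset.univ.filter fun v => g v ≠ 0 := by
        refine Finset.eq_of_subset_of_card_le (fun v hv => ?_) (hg.supp_le.trans h)
        simp only [Finset.mem_filter, Finset.mem_univ, true_and] at hv ⊢
        rwa [← hext v hv]
      funext v
      by_cases hv : run G C L w L v = 0
      · have : v ∉ Finset.univ.filter fun v => g v ≠ 0 := by
          rw [← hs]; simpa using hv
        rw [hv]
        by_contra hne
        exact this (Finset.mem_filter.2 ⟨Finset.mem_univ _, Ne.symm hne⟩)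
      · exact hext v hv
  rw [this]
  exact hg.accepts

/-! ### Words as numbers -/

/-- The number with the digits `w 0, …, w (L - 1)` in base `B`. -/
def wordVal (B L : ℕ) (w : ℕ → ℕ) : ℕ := ∑ j ∈ Finset.range L, w j * B ^ j

theorem wordVal_lt {B L : ℕ} {w : ℕ → ℕ} (hw : ∀ j < L, w j < B) : wordVal B L w < B ^ L := by
  induction L with
  | zero => simp [wordVal]
  | succ L ih =>
    have h1 := ih fun j hj => hw j (by omega)
    have h2 : w L + 1 ≤ B := hw L (by omega)
    have h3 : wordVal B (L + 1) w = wordVal B L w + w L * B ^ L := Finset.sum_range_succ _ _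
    rw [h3, pow_succ']
    calc wordVal B L w + w L * B ^ L < B ^ L + w L * B ^ L := by omega
      _ = (w L + 1) * B ^ L := by ring
      _ ≤ B * B ^ L := Nat.mul_le_mul_right _ h2

theorem wordVal_inj {B L : ℕ} {w w' : ℕ → ℕ} (hw : ∀ j < L, w j < B) (hw' : ∀ j < L, w' j < B)
    (h : wordVal B L w = wordVal B L w') : ∀ j < L, w j = w' j := by
  induction L with
  | zero => intro j hj; omega
  | succ L ih =>
    have h1 := wordVal_lt fun j (hj : j < L) => hw j (by omega)
    have h2 := wordVal_lt fun j (hj : j < L) => hw' j (by omega)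
    have h3 : wordVal B (L + 1) w = wordVal B L w + w L * B ^ L := Finset.sum_range_succ _ _
    have h4 : wordVal B (L + 1) w' = wordVal B L w' + w' L * B ^ L := Finset.sum_range_succ _ _
    rw [h3, h4] at h
    have hB : 0 < B ^ L := by omega
    have hq := congrArg (· / B ^ L) h
    simp only [Nat.add_mul_div_right _ _ hB, Nat.div_eq_of_lt h1, Nat.div_eq_of_lt h2,
      zero_add] at hq
    rw [hq] at h
    intro j hj
    rcases Nat.lt_succ_iff_lt_or_eq.1 hj with hj | rfl
    · exact ih (fun j hj => hw j (by omega)) (fun j hj => hw' j (by omega)) (by omega) j hj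
    · exact hq

open RAM RAM.Tm

/-! ### The terms of the program

Register `0` holds `n`, register `1` holds `k`, register `2` holds `L = 4 * k`; array `0` holds the
adjacency matrix, array `1` the set `C`, array `2` the colouring and array `3` the word. -/

section Quantifiers

variable {x : ℕ} {t : Tm} {s : Store} {P : Fin n → Prop}

theorem holds_ex_iff (hn : s.reg 0 = n) (h : ∀ i : Fin n, t.Holds (s.setReg x i) ↔ P i) :
    (ex x t).Holds s ↔ ∃ i, P i := by
  rw [holds_ex, hn, Fin.exists_iff]
  exact exists_congr fun i => by
    rw [← exists_prop]
    exact exists_congr fun hi => h ⟨i, hi⟩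

theorem holds_all_iff (hn : s.reg 0 = n) (h : ∀ i : Fin n, t.Holds (s.setReg x i) ↔ P i) :
    (all x t).Holds s ↔ ∀ i, P i := by
  rw [holds_all, hn, Fin.forall_iff]
  exact forall₂_congr fun i hi => h ⟨i, hi⟩

theorem eval_count_eq (hn : s.reg 0 = n) (h : ∀ i : Fin n, t.Holds (s.setReg x i) ↔ P i) :
    (count x t).eval s = (Finset.univ.filter P).card := by
  rw [eval_count, hn, Finset.card_filter, Finset.card_filter, Finset.sum_range]
  exact Finset.sum_congr rfl fun i _ => by simp only [h i]

end Quantifiers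

/-- The content of the cell of array `a` whose number is in register `x`. -/
def cell (a x : ℕ) : Tm := arr a (reg x)

/-- The vertices in the registers `x` and `y` are adjacent. -/
def adj (x y : ℕ) : Tm := entry 15 (reg x) (reg y)

/-- The vertices in the registers `x` and `y` are in the same part. -/
def same (x y : ℕ) : Tm := or (eq (reg x) (reg y)) (and (cell 2 x) (eq (cell 2 x) (cell 2 y)))

/-- A vertex outside `C`, different and not adjacent to the vertex in register `7`, which is not in
`C` either. -/
def mate : Tm :=
  least 11 10 (and (not (cell 1 7)) (and (not (cell 1 10))
    (and (not (eq (reg 7) (reg 10))) (not (adj 7 10)))))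

/-- The vertex in register `10` has no neighbour in some part whose colour is at most `L`. -/
def bad : Tm :=
  ex 12 (and (and (lt (lit 0) (cell 2 12)) (not (lt (reg 2) (cell 2 12))))
    (all 13 (or (not (eq (cell 2 13) (cell 2 12))) (not (adj 13 10)))))

/-- The first uncoloured vertex of `C`. -/
def pickCover : Tm := least 11 10 (and (not (cell 2 10)) (cell 1 10))

/-- The first uncoloured bad vertex. -/
def pickBad : Tm := least 11 10 (and (not (cell 2 10)) bad)

/-- The first uncoloured vertex. -/
def pickAny : Tm := least 11 10 (not (cell 2 10))

/-- The colouring is accepted. -/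
def accepted : Tm :=
  and (all 10 (all 11 (or (same 10 11)
      (ex 12 (ex 13 (and (same 10 12) (and (same 11 13) (adj 12 13))))))))
    (not (lt (reg 1) (count 10 (ex 11 (and (lt (reg 11) (reg 10)) (same 11 10))))))

/-- The store holds the instance and `L`. -/
structure Ctx (G : SimpleGraph (Fin n)) (k : ℕ) (s : Store) : Prop where
  reg0 : s.reg 0 = n
  reg1 : s.reg 1 = k
  reg2 : s.reg 2 = 4 * k
  adj : ∀ u v : Fin n, s.arr 0 ((u : ℕ) * n + v) ≠ 0 ↔ G.Adj u v

/-- Array `1` holds `C`. -/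
def HasCover (C : Finset (Fin n)) (s : Store) : Prop := ∀ v : Fin n, s.arr 1 v ≠ 0 ↔ v ∈ C

/-- Array `2` holds `col`. -/
def HasColoring (col : Fin n → ℕ) (s : Store) : Prop := ∀ v : Fin n, s.arr 2 v = col v

section Terms

variable {G : SimpleGraph (Fin n)} {k : ℕ} {C : Finset (Fin n)} {col : Fin n → ℕ} {s : Store}

@[simp] theorem holds_adj {x y : ℕ} (hx : x ≠ 15) :
    (CliqueId.adj x y).Holds s ↔ s.arr 0 (s.reg x * s.reg 0 + s.reg y) ≠ 0 := by
  rw [CliqueId.adj, Holds, eval_entry fun i => by simp [eval, hx]]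
  rfl

@[simp] theorem eval_reg {x : ℕ} : (reg x).eval s = s.reg x := rfl

@[simp] theorem eval_lit {m : ℕ} : (lit m).eval s = m := rfl

@[simp] theorem eval_cell {a x : ℕ} : (cell a x).eval s = s.arr a (s.reg x) := rfl

@[simp] theorem holds_cell {a x : ℕ} : (cell a x).Holds s ↔ s.arr a (s.reg x) ≠ 0 := Iff.rfl

theorem holds_same (hcol : HasColoring col s) {x y : ℕ} {u v : Fin n} (hu : s.reg x = u)
    (hv : s.reg y = v) : (same x y).Holds s ↔ Same col u v := by
  simp [same, Same, hu, hv, hcol u, hcol v, Fin.ext_iff]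

theorem eval_mate (h : Ctx G k s) (hC : HasCover C s) {x : Fin n} (hx : s.reg 7 = x) :
    mate.eval s = leastFin fun v => x ∉ C ∧ v ∉ C ∧ x ≠ v ∧ ¬ G.Adj x v := by
  refine eval_least (by omega) (by omega) h.reg0 fun i hi j => ?_
  have h1 := hC x
  have h2 := hC ⟨i, hi⟩
  have h3 := h.adj x ⟨i, hi⟩
  simp only [] at h2 h3
  simp [hx, h.reg0, ← h1, ← h2, ← h3, Fin.ext_iff]

theorem holds_bad (h : Ctx G k s) (hcol : HasColoring col s) {v : Fin n} (hv : s.reg 10 = v) :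
    bad.Holds s ↔ Bad G (4 * k) col v := by
  refine holds_ex_iff h.reg0 fun c => holds_and.trans (and_congr ?_ ?_)
  · simp [hcol c, h.reg2]
  · refine holds_all_iff (by simp [h.reg0]) fun c' => ?_
    simp [hcol c, hcol c', hv, h.reg0, ← h.adj, imp_iff_not_or]

theorem eval_pickCover (h : Ctx G k s) (hC : HasCover C s) (hcol : HasColoring col s) :
    pickCover.eval s = leastFin fun v => col v = 0 ∧ v ∈ C := by
  refine eval_least (by omega) (by omega) h.reg0 fun i hi j => ?_
  have h1 := hC ⟨i, hi⟩
  have h2 := hcol ⟨i, hi⟩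
  simp only [] at h1 h2
  simp [← h1, h2]

theorem eval_pickBad (h : Ctx G k s) (hcol : HasColoring col s) :
    pickBad.eval s = leastFin fun v => col v = 0 ∧ Bad G (4 * k) col v := by
  refine eval_least (by omega) (by omega) h.reg0 fun i hi j => ?_
  have h2 := hcol ⟨i, hi⟩
  simp only [] at h2
  refine holds_and.trans (and_congr (by simp [h2]) ?_)
  exact holds_bad (k := k) (v := ⟨i, hi⟩) (s := (s.setReg 11 j).setReg 10 i)
    ⟨by simp [h.reg0], by simp [h.reg1], by simp [h.reg2], h.adj⟩ hcol (by simp)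

theorem eval_pickAny (h : Ctx G k s) (hcol : HasColoring col s) :
    pickAny.eval s = leastFin fun v => col v = 0 := by
  refine eval_least (by omega) (by omega) h.reg0 fun i hi j => ?_
  have h2 := hcol ⟨i, hi⟩
  simp only [] at h2
  simp [h2]

theorem holds_accepted (h : Ctx G k s) (hcol : HasColoring col s) :
    accepted.Holds s ↔ Accepts G k col := by
  unfold Accepts Complete
  refine holds_and.trans (and_congr ?_ ?_)
  · refine holds_all_iff h.reg0 fun u => holds_all_iff (n := n) (by simp [h.reg0]) fun v =>
      holds_or.trans (or_congr ?_ ?_)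
    · refine holds_same (u := u) (v := v) ?_ ?_ ?_
      exact hcol
      all_goals simp
    · refine holds_ex_iff (n := n) (by simp [h.reg0]) fun u' =>
        holds_ex_iff (n := n) (by simp [h.reg0]) fun v' =>
          holds_and.trans (and_congr ?_ (holds_and.trans (and_congr ?_ ?_)))
      · refine holds_same (u := u) (v := u') ?_ ?_ ?_
        exact hcol
        all_goals simp
      · refine holds_same (u := v) (v := v') ?_ ?_ ?_
        exact hcol
        all_goals simp
      · simp [h.reg0, ← h.adj]
  · rw [holds_not, holds_lt, eval_reg, h.reg1, not_lt]
    refine iff_of_eq (congrArg (· ≤ k) ((eval_count_eq h.reg0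
      (P := fun u => ∃ v, v < u ∧ Same col v u) ?_).trans (by congr!)))
    refine fun u => holds_ex_iff (n := n) (by simp [h.reg0]) fun v =>
      holds_and.trans (and_congr ?_ ?_)
    · simp
    · refine holds_same (u := v) (v := u) ?_ ?_ ?_
      exact hcol
      all_goals simp

end Terms

theorem ctx_input (G : SimpleGraph (Fin n)) (k : ℕ) (s : Store)
    (h : s = (input G k).setReg 2 (4 * k)) : Ctx G k s := by
  subst h
  refine ⟨by simp [input], by simp [input], by simp, fun u v => ?_⟩
  simp only [input, Store.setReg_arr, true_and, ne_eq, ite_eq_right_iff, one_ne_zero, imp_false,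
    not_not]
  constructor
  · rintro ⟨i, j, hij, ha⟩
    have hn : 0 < n := u.pos
    -- Division with remainder by `n` recovers row and column from the cell number.
    have hq := congrArg (· / n) hij
    have hr := congrArg (· % n) hij
    simp only [Nat.mul_comm _ n, Nat.mul_add_div hn, Nat.div_eq_of_lt v.2, Nat.div_eq_of_lt j.2,
      Nat.mul_add_mod, Nat.mod_eq_of_lt v.2, Nat.mod_eq_of_lt j.2] at hq hr
    rwa [show u = i from Fin.ext (by omega), show v = j from Fin.ext hr]
  · exact fun ha => ⟨u, v, rfl, ha⟩

/-! ### The program -/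

/-- Only the registers in `R`, the auxiliary registers and the arrays in `A` may have changed. -/
structure Frame (R A : List ℕ) (s s' : Store) : Prop where
  reg : ∀ x < 20, x ∉ R → s'.reg x = s.reg x
  arr : ∀ a ∉ A, s'.arr a = s.arr a

theorem Frame.trans {R A : List ℕ} {s s' s'' : Store} (h : Frame R A s s')
    (h' : Frame R A s' s'') : Frame R A s s'' :=
  ⟨fun x hx hR => (h'.reg x hx hR).trans (h.reg x hx hR),
    fun a ha => (h'.arr a ha).trans (h.arr a ha)⟩

theorem Frame.ctx {R A : List ℕ} {s s' : Store} (h : Frame R A s s') {G : SimpleGraph (Fin n)}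
    {k : ℕ} (hs : Ctx G k s) (h0 : 0 ∉ R := by simp) (h1 : 1 ∉ R := by simp)
    (h2 : 2 ∉ R := by simp) (hA : 0 ∉ A := by simp) : Ctx G k s' :=
  ⟨by rw [h.reg 0 (by omega) h0, hs.reg0], by rw [h.reg 1 (by omega) h1, hs.reg1],
    by rw [h.reg 2 (by omega) h2, hs.reg2], by rw [h.arr 0 hA]; exact hs.adj⟩

theorem Frame.hasCover {R A : List ℕ} {s s' : Store} (h : Frame R A s s') {C : Finset (Fin n)}
    (hs : HasCover C s) (hA : 1 ∉ A := by simp) : HasCover C s' := by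
  rw [HasCover, h.arr 1 hA]; exact hs

theorem Frame.hasColoring {R A : List ℕ} {s s' : Store} (h : Frame R A s s') {col : Fin n → ℕ}
    (hs : HasColoring col s) (hA : 2 ∉ A := by simp) : HasColoring col s' := by
  rw [HasColoring, h.arr 2 hA]; exact hs

/-! ### The greedy matching in the complement -/

/-- One step of the greedy maximal matching in the complement. -/
def matchStep : Prog :=
  .seq (Tm.set 8 mate) <| .seq (.cond (.lt (.reg 8) (.reg 0))
    (.seq (.store 1 (.reg 7) (.lit 1)) (.store 1 (.reg 8) (.lit 1))) .skip)
    (.assign 7 (.add (.reg 7) (.lit 1)))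

/-- Put the vertices of a greedy maximal matching in the complement into `C`. -/
def matching : Prog := .seq (.assign 7 (.lit 0)) (.loop (.lt (.reg 7) (.reg 0)) matchStep)

/-- The running time of `matching`. -/
def matchingCost (n : ℕ) : ℕ := 2 + (n * (4 + (mate.cost n + 2 + (10 + 4))) + 4)

theorem wp_matchStep {G : SimpleGraph (Fin n)} {k : ℕ} {C : Finset (Fin n)} {s : Store}
    (h : Ctx G k s) (hC : HasCover C s) (hhalf : HalfCovered G C) {x : Fin n}
    (hx : s.reg 7 = x) :
    WP matchStep (mate.cost n + 2 + (10 + 4)) s fun s' => Frame [7, 8] [1] s s' ∧ s'.reg 7 = x + 1 ∧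
      ∃ C', HasCover C' s' ∧ HalfCovered G C' ∧ C ⊆ C' ∧
        (x ∈ C' ∨ ∀ v ∉ C', x ≠ v → G.Adj x v) := by
  refine WP.seq (WP.mono (wp_set (t := mate)
    (by simp [mate, least, count, cell, adj, entry, Below, Tm.and, Tm.or, Tm.not, Tm.eq, all, ex]))
    (by rw [h.reg0]) fun s₁ h₁ => WP.seq ?_)
  have he := eval_mate h hC hx
  have h18 : s₁.reg 8 = mate.eval s := by rw [h₁.reg 8 (by omega)]; simp
  have h17 : s₁.reg 7 = x := by rw [h₁.reg 7 (by omega)]; simp [hx]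
  have h10 : s₁.reg 0 = n := by rw [h₁.reg 0 (by omega)]; simp [h.reg0]
  have harr : s₁.arr = s.arr := h₁.arr
  have hf : Frame [7, 8] [1] s s₁ :=
    ⟨fun y hy hR => by
      rw [h₁.reg y hy]; simp at hR; simp [hR], fun a _ => by rw [harr]⟩
  rcases leastFin_spec fun v => x ∉ C ∧ v ∉ C ∧ x ≠ v ∧ ¬ G.Adj x v with
    ⟨hlt, hxC, hvC, hxv, hadj⟩ | ⟨heq, hall⟩
  · rw [← he] at hlt
    simp only [← he] at hvC hxv hadj
    refine WP.mono (T := 10) (WP.cond (T := 6)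
      (fun _ => WP.seq (WP.store (WP.store ?_))) fun h0 => ?_) le_rfl (fun _ h => h)
    · refine WP.assign ⟨⟨fun y hy hR => ?_, fun a ha => ?_⟩, ?_, insert x (insert ⟨_, hlt⟩ C),
        fun v => ?_, hhalf.insert_insert hxC hvC hxv hadj, ?_, ?_⟩
      · have := hf.reg y hy hR
        simp at hR
        simp [hR.1, this]
      · have := hf.arr a ha
        simp at ha
        simp [ha, this]
      · simp [Expr.eval, h17]
      · have := hC v
        simp only [Expr.eval, Store.setReg_arr, Store.setArr_arr, if_true, Store.setArr_reg, h17,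
          h18, Function.update_apply, harr, Finset.mem_insert, ← this, Fin.ext_iff]
        split_ifs with h1 h2 <;> simp_all
      · intro v hv; simp [hv]
      · simp
    · exfalso
      simp [Expr.eval, h18, h10, hlt] at h0
  · rw [← he] at heq
    refine WP.mono (T := 5) (WP.cond (T := 1) (fun h0 => ?_) fun _ => WP.skip ?_)
      (by omega) (fun _ h => h)
    · exfalso
      simp [Expr.eval, h18, h10, heq] at h0
    · refine WP.assign ⟨⟨fun y hy hR => ?_, fun a ha => ?_⟩, ?_, C, fun v => ?_, hhalf,
        Finset.Subset.refl _, ?_⟩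
      · have := hf.reg y hy hR
        simp at hR
        simp [hR.1, this]
      · simpa using hf.arr a ha
      · simp [Expr.eval, h17]
      · simpa [harr] using hC v
      · by_cases hxC : x ∈ C
        · exact Or.inl hxC
        · right
          intro v hv hxv
          by_contra hadj
          exact hall v ⟨hxC, hv, hxv, hadj⟩

/-- A processed vertex that stays outside `C` had no mate outside `C` at that time, and this
persists because `C` only grows. -/
theorem wp_matching {G : SimpleGraph (Fin n)} {k : ℕ} {s : Store} (h : Ctx G k s)
    (hs : ∀ i, s.arr 1 i = 0) :
    WP matching (matchingCost n) s fun s' => Frame [7, 8] [1] s s' ∧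
      ∃ C, HasCover C s' ∧ HalfCovered G C ∧ ∀ u ∉ C, ∀ v ∉ C, u ≠ v → G.Adj u v := by
  refine WP.seq (WP.assign ?_)
  refine WP.mono (WP.loop (fun i s' => Frame [7, 8] [1] s s' ∧ s'.reg 7 = i ∧
    ∃ C, HasCover C s' ∧ HalfCovered G C ∧
      ∀ u : Fin n, (u : ℕ) < i → u ∈ C ∨ ∀ v ∉ C, u ≠ v → G.Adj u v) n
    (T := mate.cost n + 2 + (10 + 4)) ?_ ?_ ?_) le_rfl ?_
  · rintro i hi s₁ ⟨hf, h7, C, hC, hhalf, hmax⟩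
    have hctx := hf.ctx h
    refine ⟨by simp [Expr.eval, h7, hctx.reg0, hi], ?_⟩
    refine (wp_matchStep hctx hC hhalf (x := ⟨i, hi⟩) h7).mono le_rfl ?_
    rintro s₂ ⟨hf₂, h7₂, C', hC', hhalf', hsub, hx⟩
    refine ⟨hf.trans hf₂, h7₂, C', hC', hhalf', fun u hu => ?_⟩
    rcases Nat.lt_succ_iff_lt_or_eq.1 hu with hu | hu
    · exact (hmax u hu).imp (fun h => hsub h) fun h v hv => h v fun hvC => hv (hsub hvC)
    · rwa [show u = ⟨i, hi⟩ from Fin.ext hu]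
  · rintro s₁ ⟨hf, h7, -⟩
    simp [Expr.eval, h7, (hf.ctx h).reg0]
  · refine ⟨⟨fun y hy hR => ?_, fun a _ => by simp⟩, by simp [Expr.eval], ∅,
      fun v => by simp [hs], fun S _ => by simp, fun u hu => absurd hu (by omega)⟩
    simp at hR
    simp [hR]
  · rintro s₁ ⟨hf, -, C, hC, hhalf, hmax⟩
    exact ⟨hf, C, hC, hhalf, fun u hu v hv huv => (hmax u u.2).resolve_left hu v hv huv⟩

/-! ### Building the colouring of one word -/

/-- Uncolour all vertices. -/
def clear : Prog :=
  .seq (.assign 7 (.lit 0)) (.loop (.lt (.reg 7) (.reg 0))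
    (.seq (.store 2 (.reg 7) (.lit 0)) (.assign 7 (.add (.reg 7) (.lit 1)))))

/-- The running time of `clear`. -/
def clearCost (n : ℕ) : ℕ := 2 + (n * (4 + (3 + 4)) + 4)

theorem wp_clear {s : Store} (hn : s.reg 0 = n) :
    WP clear (clearCost n) s fun s' => Frame [7] [2] s s' ∧
      HasColoring (fun _ : Fin n => 0) s' := by
  refine WP.seq (WP.assign ?_)
  refine WP.mono (WP.loop (fun i s' => Frame [7] [2] s s' ∧ s'.reg 7 = i ∧
    ∀ v < i, s'.arr 2 v = 0) n (T := 3 + 4) ?_ ?_ ?_) le_rfl ?_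
  · rintro i hi s₁ ⟨hf, h7, hz⟩
    refine ⟨by simp [Expr.eval, h7, hf.reg 0, hn, hi], WP.seq (WP.store (WP.assign
      ⟨⟨fun y hy hR => ?_, fun a ha => ?_⟩, ?_, fun v hv => ?_⟩))⟩
    · have := hf.reg y hy hR
      simp at hR
      simp [hR, this]
    · have := hf.arr a ha
      simp at ha
      simp [ha, this]
    · simp [Expr.eval, h7]
    · simp only [Expr.eval, Store.setReg_arr, Store.setArr_arr, if_true, h7, Function.update_apply]
      split_ifs
      · rfl
      · exact hz v (by omega)
  · rintro s₁ ⟨hf, h7, -⟩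
    simp [Expr.eval, h7, hf.reg 0, hn]
  · refine ⟨⟨fun y hy hR => ?_, fun a _ => by simp⟩, by simp [Expr.eval],
      fun v hv => absurd hv (by omega)⟩
    simp at hR
    simp [hR]
  · rintro s₁ ⟨hf, -, hz⟩
    exact ⟨hf, fun v => hz v v.2⟩

/-- Find the next vertex. -/
def findNext : Prog :=
  .seq (Tm.set 4 pickCover) <| .cond (.lt (.reg 4) (.reg 0)) .skip <|
    .seq (Tm.set 4 pickBad) <| .cond (.lt (.reg 4) (.reg 0)) .skip (Tm.set 4 pickAny)

/-- The running time of `findNext`. -/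
def findNextCost (n : ℕ) : ℕ :=
  pickCover.cost n + 2 + (4 + (pickBad.cost n + 2 + (4 + (pickAny.cost n + 2))))

theorem wp_findNext {G : SimpleGraph (Fin n)} {k : ℕ} {C : Finset (Fin n)} {col : Fin n → ℕ}
    {s : Store} (h : Ctx G k s) (hC : HasCover C s) (hcol : HasColoring col s) :
    WP findNext (findNextCost n) s fun s' => Frame [4] [] s s' ∧
      s'.reg 4 = pick G C (4 * k) col := by
  have hset : ∀ {t : Tm}, t.Below 20 → ∀ {s₁ : Store}, Frame [4] [] s s₁ →
      WP (Tm.set 4 t) (t.cost n + 2) s₁ fun s' => Frame [4] [] s s' ∧ s'.reg 4 = t.eval s₁ := by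
    intro t ht s₁ hf
    refine (wp_set ht).mono (by rw [(hf.ctx h).reg0]) fun s₂ h₂ => ⟨⟨fun y hy hR => ?_, ?_⟩, ?_⟩
    · rw [← hf.reg y hy hR, h₂.reg y hy]
      simp at hR
      simp [hR]
    · intro a ha
      rw [← hf.arr a ha, h₂.arr]
      rfl
    · rw [h₂.reg 4 (by omega)]
      simp
  have hskip : ∀ {T : ℕ} {s₁ : Store} {Q : Store → Prop}, 1 ≤ T → Q s₁ → WP Prog.skip T s₁ Q :=
    fun hT hQ => (WP.skip hQ).mono hT fun _ h => h
  refine WP.seq ((hset (t := pickCover)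
    (by simp [pickCover, least, count, cell, Below, Tm.and, Tm.or, Tm.not, all, ex])
    ⟨fun _ _ _ => rfl, fun _ _ => rfl⟩).mono le_rfl ?_)
  rintro s₁ ⟨hf₁, h4⟩
  rw [eval_pickCover h hC hcol] at h4
  have e₁ : (Expr.lt (.reg 4) (.reg 0)).eval s₁ =
      if leastFin (fun v => col v = 0 ∧ v ∈ C) < n then 1 else 0 := by
    simp [Expr.eval, h4, (hf₁.ctx h).reg0]
  refine WP.cond (fun he => hskip (by omega) ⟨hf₁, ?_⟩) fun he => WP.seq ((hset (t := pickBad)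
    (by simp [pickBad, bad, adj, entry, least, count, cell, Below, Tm.and, Tm.or, Tm.not, Tm.eq,
      all, ex]) hf₁).mono le_rfl ?_)
  · rw [h4, pick, if_pos]
    by_contra hcon
    exact he (by rw [e₁, if_neg hcon])
  have hn₁ : ¬ leastFin (fun v => col v = 0 ∧ v ∈ C) < n := fun hcon => by
    rw [e₁, if_pos hcon] at he
    exact one_ne_zero he
  rintro s₂ ⟨hf₂, h4⟩
  rw [eval_pickBad (hf₁.ctx h) (hf₁.hasColoring hcol)] at h4
  have e₂ : (Expr.lt (.reg 4) (.reg 0)).eval s₂ =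
      if leastFin (fun v => col v = 0 ∧ Bad G (4 * k) col v) < n then 1 else 0 := by
    simp [Expr.eval, h4, (hf₂.ctx h).reg0]
  refine WP.cond (fun he => hskip (by omega) ⟨hf₂, ?_⟩) fun he => (hset (t := pickAny)
    (by simp [pickAny, least, count, cell, Below, Tm.or, Tm.not, all, ex]) hf₂).mono le_rfl ?_
  · rw [h4, pick, if_neg hn₁, if_pos]
    by_contra hcon
    exact he (by rw [e₂, if_neg hcon])
  have hn₂ : ¬ leastFin (fun v => col v = 0 ∧ Bad G (4 * k) col v) < n := fun hcon => by
    rw [e₂, if_pos hcon] at he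
    exact one_ne_zero he
  rintro s₃ ⟨hf₃, h4⟩
  rw [eval_pickAny (hf₂.ctx h) (hf₂.hasColoring hcol)] at h4
  exact ⟨hf₃, by rw [h4, pick, if_neg hn₁, if_neg hn₂]⟩

/-- Colour `L` vertices in turn, with the colours given by the word. -/
def rounds : Prog :=
  .seq (.assign 3 (.lit 0)) (.loop (.lt (.reg 3) (.reg 2))
    (.seq findNext (.seq (.store 2 (.reg 4) (.arr 3 (.reg 3)))
      (.assign 3 (.add (.reg 3) (.lit 1))))))

/-- The running time of `rounds`. -/
def roundsCost (n k : ℕ) : ℕ := 2 + (4 * k * (4 + (findNextCost n + (4 + 4))) + 4)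

theorem wp_rounds {G : SimpleGraph (Fin n)} {k : ℕ} {C : Finset (Fin n)} {s : Store}
    (h : Ctx G k s) (hC : HasCover C s) (hcol : HasColoring (fun _ : Fin n => 0) s) :
    WP rounds (roundsCost n k) s fun s' => Frame [3, 4] [2] s s' ∧
      HasColoring (run G C (4 * k) (s.arr 3) (4 * k)) s' := by
  refine WP.seq (WP.assign ?_)
  refine WP.mono (WP.loop (fun i s' => Frame [3, 4] [2] s s' ∧ s'.reg 3 = i ∧
    HasColoring (run G C (4 * k) (s.arr 3) i) s') (4 * k) (T := findNextCost n + (4 + 4))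
      ?_ ?_ ?_) le_rfl ?_
  · rintro i hi s₁ ⟨hf, h3, hcol₁⟩
    refine ⟨by simp [Expr.eval, h3, (hf.ctx h).reg2, hi], WP.seq ((wp_findNext (hf.ctx h)
      (hf.hasCover hC) hcol₁).mono le_rfl ?_)⟩
    rintro s₂ ⟨hf₂, h4⟩
    have h3₂ : s₂.reg 3 = i := by rw [hf₂.reg 3 (by omega) (by simp), h3]
    -- If all vertices are coloured, register `4` holds `n` and the store writes to a cell that
    -- belongs to no vertex, in accordance with `setColor`.
    refine WP.seq (WP.store (WP.assign ⟨⟨fun y hy hR => ?_, fun a ha => ?_⟩, ?_, fun v => ?_⟩))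
    · have h1 := hf.reg y hy hR
      simp at hR
      have h2 := hf₂.reg y hy (by simp [hR])
      simp [hR, h1, h2]
    · have h1 := hf.arr a ha
      have h2 := hf₂.arr a (by simp)
      simp at ha
      simp [ha, h1, h2]
    · simp [Expr.eval, h3₂]
    · have h1 := hcol₁ v
      simp only [Expr.eval, Store.setReg_arr, Store.setArr_arr, if_true, h3₂, h4,
        Function.update_apply, hf₂.arr _ List.not_mem_nil, run, setColor, h1]
      rw [hf.arr 3 (by simp)]
  · rintro s₁ ⟨hf, h3, -⟩
    simp [Expr.eval, h3, (hf.ctx h).reg2]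
  · refine ⟨⟨fun y hy hR => ?_, fun a _ => by simp⟩, by simp [Expr.eval], hcol⟩
    simp at hR
    simp [hR]
  · rintro s₁ ⟨hf, -, hcol₁⟩
    exact ⟨hf, hcol₁⟩

/-! ### Testing the colouring and enumerating the words -/

/-- Count the accepted words in register `6`. -/
def check : Prog := Tm.set 6 (.add (.reg 6) accepted)

/-- The running time of `check`. -/
def checkCost (n : ℕ) : ℕ := (Tm.add (.reg 6) accepted).cost n + 2

theorem wp_check {G : SimpleGraph (Fin n)} {k : ℕ} {col : Fin n → ℕ} {s : Store}
    (h : Ctx G k s) (hcol : HasColoring col s) :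
    WP check (checkCost n) s fun s' => Frame [6] [] s s' ∧
      (s'.reg 6 ≠ 0 ↔ s.reg 6 ≠ 0 ∨ Accepts G k col) := by
  refine (wp_set (by simp [accepted, same, cell, adj, entry, Below, count, Tm.and, Tm.or, Tm.not,
    Tm.eq, all, ex])).mono (by rw [h.reg0]; rfl) fun s₁ h₁ => ⟨⟨fun y hy hR => ?_, ?_⟩, ?_⟩
  · rw [h₁.reg y hy]
    simp at hR
    simp [hR]
  · intro a _
    rw [h₁.arr]
    rfl
  · rw [← holds_accepted h hcol, h₁.reg 6 (by omega)]
    simp only [Store.setReg_reg, if_true, Tm.eval, Holds]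
    omega

/-- Replace the word with the next one; the carry is left in register `5`. -/
def nextWord : Prog :=
  .seq (.assign 5 (.lit 1)) <| .seq (.assign 3 (.lit 0)) <| .loop (.lt (.reg 3) (.reg 2)) <|
    .seq (.store 3 (.reg 3) (.add (.arr 3 (.reg 3)) (.reg 5))) <|
    .seq (.cond (.lt (.arr 3 (.reg 3)) (.add (.add (.reg 2) (.reg 2)) (.lit 1)))
      (.assign 5 (.lit 0)) (.store 3 (.reg 3) (.lit 0))) <|
    .assign 3 (.add (.reg 3) (.lit 1))

/-- The running time of `nextWord`. -/
def nextWordCost (k : ℕ) : ℕ := 2 + (2 + (4 * k * (4 + (6 + (12 + 4))) + 4))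

/-- Addition of `1` with carry: after `i` rounds the lowest `i` digits, plus the carry times `B ^
i`, have increased by exactly `1`. A final carry of `1` means that the counter has overflowed, that
is, all words have been seen. -/
theorem wp_nextWord {G : SimpleGraph (Fin n)} {k B : ℕ} {s : Store} (h : Ctx G k s)
    (hB : B = 2 * (4 * k) + 1) (hw : ∀ j < 4 * k, s.arr 3 j < B) :
    WP nextWord (nextWordCost k) s fun s' => Frame [3, 5] [3] s s' ∧
      (∀ j < 4 * k, s'.arr 3 j < B) ∧
      wordVal B (4 * k) (s'.arr 3) + s'.reg 5 * B ^ (4 * k) = wordVal B (4 * k) (s.arr 3) + 1 := by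
  refine WP.seq (WP.assign (WP.seq (WP.assign ?_)))
  refine WP.mono (WP.loop (fun i s' => Frame [3, 5] [3] s s' ∧ s'.reg 3 = i ∧ s'.reg 5 ≤ 1 ∧
    (∀ j < 4 * k, s'.arr 3 j < B) ∧ (∀ j, i ≤ j → s'.arr 3 j = s.arr 3 j) ∧
    wordVal B i (s'.arr 3) + s'.reg 5 * B ^ i = wordVal B i (s.arr 3) + 1) (4 * k)
      (T := 6 + (12 + 4)) ?_ ?_ ?_) le_rfl ?_
  · rintro i hi s₁ ⟨hf, h3, h5, hw₁, hrest, hval⟩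
    have hctx := hf.ctx h
    refine ⟨by simp [Expr.eval, h3, hctx.reg2, hi], WP.seq (WP.store (WP.seq ?_))⟩
    have hwi := hw i hi
    have hri := hrest i le_rfl
    have hsucc : ∀ w : ℕ → ℕ, wordVal B (i + 1) w = wordVal B i w + w i * B ^ i :=
      fun w => Finset.sum_range_succ _ _
    have hupd : ∀ d, wordVal B i (Function.update (s₁.arr 3) i d) = wordVal B i (s₁.arr 3) :=
      fun d => Finset.sum_congr rfl fun j hj => by
        rw [Function.update_of_ne (Finset.mem_range.1 hj).ne]
    have e : (Expr.lt (.arr 3 (.reg 3)) (.add (.add (.reg 2) (.reg 2)) (.lit 1))).eval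
        (s₁.setArr 3 ((Expr.reg 3).eval s₁) ((Expr.add (.arr 3 (.reg 3)) (.reg 5)).eval s₁)) =
        if s.arr 3 i + s₁.reg 5 < B then 1 else 0 := by
      simp only [Expr.eval, Store.setArr_arr, Store.setArr_reg, if_true, h3, Function.update_self,
        hri, hctx.reg2]
      congr 1
      rw [hB, two_mul]
    refine WP.mono (T := 12) (WP.cond (T := 3) (fun he => ?_) fun he => ?_) le_rfl fun _ h => h
    · have hlt : s.arr 3 i + s₁.reg 5 < B := by
        by_contra hcon
        exact he (by rw [e, if_neg hcon])
      refine WP.mono (T := 2) (WP.assign (WP.assign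
        ⟨⟨fun y hy hR => ?_, fun a ha => ?_⟩, ?_, ?_, fun j hj => ?_, fun j hj => ?_, ?_⟩))
        (by omega) fun _ h => h
      · have := hf.reg y hy hR
        simp at hR
        simp [hR, this]
      · have := hf.arr a ha
        simp at ha
        simp [ha, this]
      · simp [Expr.eval, h3]
      · simp [Expr.eval]
      · simp only [Expr.eval, Store.setReg_arr, Store.setArr_arr, if_true, h3,
          Function.update_apply]
        split_ifs
        · rwa [hri]
        · exact hw₁ j hj
      · simp only [Expr.eval, Store.setReg_arr, Store.setArr_arr, if_true, h3]
        rw [Function.update_of_ne (by omega), hrest j (by omega)]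
      · simp [Expr.eval, h3, hsucc, hupd, hri]
        linarith
    -- The old digit is below `B` and the carry at most `1`, so the test fails only for digit `B -
    -- 1` with carry `1`; the digit becomes `0` and the carry is kept.
    · have hge : s.arr 3 i + s₁.reg 5 = B := by
        by_contra hcon
        rw [e, if_pos (by omega)] at he
        exact one_ne_zero he
      have h51 : s₁.reg 5 = 1 := by omega
      refine WP.mono (T := 3) (WP.store (WP.assign
        ⟨⟨fun y hy hR => ?_, fun a ha => ?_⟩, ?_, ?_, fun j hj => ?_, fun j hj => ?_, ?_⟩))
        le_rfl fun _ h => h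
      · have := hf.reg y hy hR
        simp at hR
        simp [hR, this]
      · have := hf.arr a ha
        simp at ha
        simp [ha, this]
      · simp [Expr.eval, h3]
      · simp [h51]
      · simp only [Expr.eval, Store.setReg_arr, Store.setArr_arr, if_true, Store.setArr_reg, h3,
          Function.update_idem, Function.update_apply]
        split_ifs
        · omega
        · exact hw₁ j hj
      · simp only [Expr.eval, Store.setReg_arr, Store.setArr_arr, if_true, Store.setArr_reg, h3,
          Function.update_idem]
        rw [Function.update_of_ne (by omega), hrest j (by omega)]
      · rw [h51] at hval hge
        simp [Expr.eval, h3, hsucc, hupd, h51, pow_succ']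
        rw [← hge]
        rw [← hge] at hval
        linarith
  · rintro s₁ ⟨hf, h3, -⟩
    simp [Expr.eval, h3, (hf.ctx h).reg2]
  · refine ⟨⟨fun y hy hR => ?_, fun a _ => by simp⟩, by simp [Expr.eval], by simp [Expr.eval],
      hw, fun j _ => by simp, by simp [Expr.eval, wordVal]⟩
    simp at hR
    simp [hR]
  · rintro s₁ ⟨hf, -, -, hw₁, -, hval⟩
    exact ⟨hf, hw₁, hval⟩

/-! ### The whole program -/

/-- Process one word. -/
def processWord : Prog := .seq clear <| .seq rounds <| .seq check nextWord

/-- The running time of `processWord`. -/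
def processWordCost (n k : ℕ) : ℕ :=
  clearCost n + (roundsCost n k + (checkCost n + nextWordCost k))

/-- The program that decides Clique-Identification. -/
def program : Prog :=
  .seq (.assign 2 (.add (.add (.reg 1) (.reg 1)) (.add (.reg 1) (.reg 1)))) <|
    .seq matching <| .seq (.loop (.lt (.reg 5) (.lit 1)) processWord) <|
    .assign 0 (.lt (.lit 0) (.reg 6))

/-- The running time of `program`. -/
def programCost (n k : ℕ) : ℕ :=
  8 + (matchingCost n + (((2 * (4 * k) + 1) ^ (4 * k) * (4 + processWordCost n k) + 4) + 4))

theorem wp_processWord {G : SimpleGraph (Fin n)} {k B : ℕ} {C : Finset (Fin n)} {s : Store}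
    (h : Ctx G k s) (hC : HasCover C s) (hB : B = 2 * (4 * k) + 1)
    (hw : ∀ j < 4 * k, s.arr 3 j < B) :
    WP processWord (processWordCost n k) s fun s' => Ctx G k s' ∧ HasCover C s' ∧
      (∀ j < 4 * k, s'.arr 3 j < B) ∧
      wordVal B (4 * k) (s'.arr 3) + s'.reg 5 * B ^ (4 * k) =
        wordVal B (4 * k) (s.arr 3) + 1 ∧
      (s'.reg 6 ≠ 0 ↔ s.reg 6 ≠ 0 ∨ Accepts G k (run G C (4 * k) (s.arr 3) (4 * k))) := by
  refine WP.seq ((wp_clear h.reg0).mono le_rfl ?_)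
  rintro s₁ ⟨hf₁, hcol₁⟩
  have h₁ := hf₁.ctx h
  have hC₁ := hf₁.hasCover hC
  refine WP.seq ((wp_rounds h₁ hC₁ hcol₁).mono le_rfl ?_)
  rintro s₂ ⟨hf₂, hcol₂⟩
  have h₂ := hf₂.ctx h₁
  have hC₂ := hf₂.hasCover hC₁
  refine WP.seq ((wp_check h₂ hcol₂).mono le_rfl ?_)
  rintro s₃ ⟨hf₃, h6⟩
  have h₃ := hf₃.ctx h₂
  have hC₃ := hf₃.hasCover hC₂
  have harr₁ : s₁.arr 3 = s.arr 3 := hf₁.arr 3 (by simp)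
  have harr : s₃.arr 3 = s.arr 3 := by
    rw [hf₃.arr 3 (by simp), hf₂.arr 3 (by simp), harr₁]
  refine (wp_nextWord h₃ hB (by rwa [harr])).mono le_rfl ?_
  rintro s₄ ⟨hf₄, hw₄, hval⟩
  refine ⟨hf₄.ctx h₃, hf₄.hasCover hC₃, hw₄, by rw [hval, harr], ?_⟩
  rw [hf₄.reg 6 (by omega) (by simp), h6, hf₂.reg 6 (by omega) (by simp),
    hf₁.reg 6 (by omega) (by simp), harr₁]

theorem wp_program (G : SimpleGraph (Fin n)) (k : ℕ) :
    WP program (programCost n k) (input G k) fun s =>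
      s.reg 0 = if CliqueIdentification G k then 1 else 0 := by
  obtain ⟨B, hB⟩ : ∃ B, B = 2 * (4 * k) + 1 := ⟨_, rfl⟩
  refine WP.seq (WP.assign ?_)
  set s₀ := (input G k).setReg 2
    ((Expr.add (.add (.reg 1) (.reg 1)) (.add (.reg 1) (.reg 1))).eval (input G k)) with hs₀
  have h₀ : Ctx G k s₀ := ctx_input G k s₀ (by
    rw [hs₀]
    congr 1
    simp [Expr.eval, input]
    omega)
  refine WP.seq ((wp_matching h₀ fun i => by simp [hs₀, input]).mono le_rfl ?_)
  rintro s₁ ⟨hf₁, C, hC, hhalf, hclique⟩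
  -- The words are processed in the order of their values, starting from `0`. The value plus the
  -- overflow is the number `i` of finished words, so the carry becomes nonzero exactly after `B ^
  -- (4 * k)` rounds. Register `6` is nonzero only on yes-instances, and it is nonzero as soon as an
  -- accepted word has value below `i`.
  refine WP.seq (WP.mono
    (WP.loop (T := processWordCost n k) (fun i s => Ctx G k s ∧ HasCover C s ∧
      (∀ j < 4 * k, s.arr 3 j < B) ∧
      wordVal B (4 * k) (s.arr 3) + s.reg 5 * B ^ (4 * k) = i ∧
      (s.reg 6 ≠ 0 → CliqueIdentification G k) ∧
      ∀ w : ℕ → ℕ, (∀ j, w j < B) → wordVal B (4 * k) w < i →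
        Accepts G k (run G C (4 * k) w (4 * k)) → s.reg 6 ≠ 0) (B ^ (4 * k)) ?_ ?_ ?_)
    (by rw [← hB]; rfl) ?_)
  · rintro i hi s ⟨h, hCs, hw, hval, hsound, hcomp⟩
    have h5 : s.reg 5 = 0 := by
      by_contra hne
      have := Nat.le_mul_of_pos_left (B ^ (4 * k)) (Nat.pos_of_ne_zero hne)
      omega
    refine ⟨by simp [Expr.eval, h5], (wp_processWord h hCs hB hw).mono le_rfl ?_⟩
    rintro s' ⟨h', hC', hw', hval', h6⟩
    rw [h5, zero_mul, add_zero] at hval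
    refine ⟨h', hC', hw', by rw [hval', hval], fun hne => ?_, fun w hwB hlt hacc => ?_⟩
    · rcases h6.1 hne with hne | hacc
      · exact hsound hne
      · exact hacc.cliqueIdentification
    · rw [h6]
      rcases Nat.lt_succ_iff_lt_or_eq.1 hlt with hlt | heq
      · exact Or.inl (hcomp w hwB hlt hacc)
      · right
        rwa [← run_congr (4 * k) (wordVal_inj (fun j _ => hwB j) hw (heq.trans hval.symm))]
  · rintro s ⟨-, -, hw, hval, -⟩
    have hlt := wordVal_lt hw
    have h5 : s.reg 5 ≠ 0 := by
      intro h0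
      rw [h0, zero_mul] at hval
      omega
    refine if_neg ?_
    simp only [Expr.eval]
    omega
  · have harr : ∀ j, s₁.arr 3 j = 0 := fun j => by
      rw [hf₁.arr 3 (by simp)]
      simp [hs₀, input]
    have hreg : ∀ x, x = 5 ∨ x = 6 → s₁.reg x = 0 := by
      rintro x (rfl | rfl) <;> rw [hf₁.reg _ (by omega) (by simp)] <;> simp [hs₀, input]
    refine ⟨hf₁.ctx h₀, hC, fun j _ => by rw [harr]; omega, ?_,
      fun h => absurd (hreg 6 (Or.inr rfl)) h, fun w _ h => absurd h (by omega)⟩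
    rw [hreg 5 (Or.inl rfl)]
    simp [wordVal, harr]
  · rintro s ⟨-, -, -, -, hsound, hcomp⟩
    refine WP.assign ?_
    have : s.reg 6 ≠ 0 ↔ CliqueIdentification G k := by
      refine ⟨hsound, fun hyes => ?_⟩
      obtain ⟨g, hg⟩ := exists_isSol hhalf hyes
      obtain ⟨w, hw, hacc⟩ := hg.exists_word hclique
      have hwB : ∀ j, w j < B := fun j => by have := hw j; omega
      exact hcomp w hwB (wordVal_lt fun j _ => hwB j) hacc
    rw [← Nat.pos_iff_ne_zero] at this
    simp [Expr.eval, this]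

end CliqueId

namespace CliqueId

open RAM

/-! ### The running time -/

/-- The function is bounded by a polynomial. -/
def PolyBounded (f : ℕ → ℕ → ℕ) : Prop := ∃ a, ∀ n k, f n k ≤ a * ((n + 1) * (k + 1)) ^ a

theorem PolyBounded.of_le {f : ℕ → ℕ → ℕ} {a b : ℕ}
    (h : ∀ n k, f n k ≤ a * ((n + 1) * (k + 1)) ^ b) : PolyBounded f :=
  ⟨a + b, fun n k => (h n k).trans (Nat.mul_le_mul (by omega)
    (Nat.pow_le_pow_right (by positivity) (by omega)))⟩

theorem PolyBounded.const (m : ℕ) : PolyBounded fun _ _ => m :=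
  .of_le (a := m) (b := 0) fun n k => by simp

theorem PolyBounded.fst : PolyBounded fun n _ => n :=
  .of_le (a := 1) (b := 1) fun n k => by nlinarith [Nat.zero_le (n * k)]

theorem PolyBounded.snd : PolyBounded fun _ k => k :=
  .of_le (a := 1) (b := 1) fun n k => by nlinarith [Nat.zero_le (n * k)]

theorem PolyBounded.add {f g : ℕ → ℕ → ℕ} (hf : PolyBounded f) (hg : PolyBounded g) :
    PolyBounded fun n k => f n k + g n k := by
  obtain ⟨a, ha⟩ := hf
  obtain ⟨b, hb⟩ := hg
  refine .of_le (a := a + b) (b := a + b) fun n k => ?_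
  rw [add_mul]
  refine Nat.add_le_add ((ha n k).trans ?_) ((hb n k).trans ?_) <;>
    exact Nat.mul_le_mul_left _ (Nat.pow_le_pow_right (by positivity) (by omega))

theorem PolyBounded.mul {f g : ℕ → ℕ → ℕ} (hf : PolyBounded f) (hg : PolyBounded g) :
    PolyBounded fun n k => f n k * g n k := by
  obtain ⟨a, ha⟩ := hf
  obtain ⟨b, hb⟩ := hg
  refine .of_le (a := a * b) (b := a + b) fun n k => ?_
  exact (Nat.mul_le_mul (ha n k) (hb n k)).trans (by rw [pow_add]; exact le_of_eq (by ring))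

theorem PolyBounded.cost (t : Tm) : PolyBounded fun n _ => t.cost n := by
  obtain ⟨a, ha⟩ := t.exists_cost_le
  refine .of_le (a := a) (b := a) fun n k => (ha n).trans ?_
  exact Nat.mul_le_mul_left _ (Nat.pow_le_pow_left (Nat.le_mul_of_pos_right _ (by omega)) _)

theorem polyBounded_matchingCost : PolyBounded fun n _ => matchingCost n :=
  (PolyBounded.const _).add ((PolyBounded.fst.mul ((PolyBounded.const _).add
    (((PolyBounded.cost _).add (.const _)).add (.const _)))).add (.const _))

theorem polyBounded_processWordCost : PolyBounded processWordCost := by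
  have h1 : PolyBounded fun n _ => clearCost n :=
    (PolyBounded.const _).add ((PolyBounded.fst.mul (.const _)).add (.const _))
  have h2 : PolyBounded fun n _ => findNextCost n :=
    ((PolyBounded.cost _).add (.const _)).add ((PolyBounded.const _).add
      (((PolyBounded.cost _).add (.const _)).add ((PolyBounded.const _).add
        ((PolyBounded.cost _).add (.const _)))))
  have h3 : PolyBounded roundsCost :=
    (PolyBounded.const _).add ((((PolyBounded.const _).mul .snd).mul
      ((PolyBounded.const _).add (h2.add (.const _)))).add (.const _))
  have h4 : PolyBounded fun n _ => checkCost n := (PolyBounded.cost _).add (.const _)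
  have h5 : PolyBounded fun _ k => nextWordCost k :=
    (PolyBounded.const _).add ((PolyBounded.const _).add
      ((((PolyBounded.const _).mul .snd).mul (.const _)).add (.const _)))
  exact h1.add (h3.add (h4.add h5))

/-- Everything except the number `(8 * k + 1) ^ (4 * k)` of words is polynomial in `n` and `k`, and
the polynomial factor in `k` is absorbed into a power `k ^ (c * k)`. -/
theorem exists_programCost_le :
    ∃ c, ∀ n k, programCost n k ≤ c * k ^ (c * k) * (n + 1) ^ c := by
  -- The `20` collects the costs `8 + 4 + 4` outside the main loop and the `4` of each of its tests.
  obtain ⟨a, ha⟩ := ((PolyBounded.const 20).add polyBounded_matchingCost).add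
    polyBounded_processWordCost
  have h1 : ∀ n k, programCost n k ≤
      a * ((8 * k + 1) ^ (4 * k) * (k + 1) ^ a) * (n + 1) ^ a := by
    intro n k
    have hB : 2 * (4 * k) + 1 = 8 * k + 1 := by ring
    have hp : 1 ≤ (8 * k + 1) ^ (4 * k) := Nat.one_le_pow _ _ (by omega)
    calc programCost n k
        ≤ (8 * k + 1) ^ (4 * k) * (20 + matchingCost n + processWordCost n k) := by
          rw [programCost, hB]
          nlinarith [Nat.mul_le_mul_right (matchingCost n) hp]
      _ ≤ (8 * k + 1) ^ (4 * k) * (a * ((n + 1) * (k + 1)) ^ a) := Nat.mul_le_mul_left _ (ha n k)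
      _ = _ := by rw [mul_pow]; ring
  have h2 : ∀ k, (8 * k + 1) ^ (4 * k) * (k + 1) ^ a ≤ 9 ^ 4 * 2 ^ a * k ^ ((20 + 2 * a) * k) := by
    intro k
    -- For `k ≤ 1` the power of `k` on the right is `1`. The left side is `1` for `k = 0` and `9 ^ 4
    -- * 2 ^ a` for `k = 1`, which dictates the constant factor.
    obtain rfl | rfl | hk : k = 0 ∨ k = 1 ∨ 2 ≤ k := by omega
    · have := Nat.one_le_two_pow (n := a)
      simp
      omega
    · simp
    · have e1 : 8 * k + 1 ≤ k ^ 5 := by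
        have : 2 ^ 4 ≤ k ^ 4 := Nat.pow_le_pow_left hk 4
        calc 8 * k + 1 ≤ 2 ^ 4 * k := by omega
          _ ≤ k ^ 4 * k := Nat.mul_le_mul_right _ this
          _ = k ^ 5 := by ring
      have e2 : k + 1 ≤ k ^ 2 := by nlinarith
      calc (8 * k + 1) ^ (4 * k) * (k + 1) ^ a
          ≤ (k ^ 5) ^ (4 * k) * (k ^ 2) ^ a :=
            Nat.mul_le_mul (Nat.pow_le_pow_left e1 _) (Nat.pow_le_pow_left e2 _)
        _ = k ^ (20 * k + 2 * a) := by rw [← pow_mul, ← pow_mul, ← pow_add]; ring_nf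
        _ ≤ k ^ ((20 + 2 * a) * k) := by
            refine Nat.pow_le_pow_right (by omega) ?_
            rw [add_mul]
            exact Nat.add_le_add_left (Nat.le_mul_of_pos_right _ (by omega)) _
        _ ≤ 9 ^ 4 * 2 ^ a * k ^ ((20 + 2 * a) * k) := Nat.le_mul_of_pos_left _ (by positivity)
  -- As a sum, `c` dominates the coefficient `a * (9 ^ 4 * 2 ^ a)` and the exponents `20 + 2 * a`
  -- and `a` at once.
  set c := a * (9 ^ 4 * 2 ^ a) + (20 + 2 * a) with hc
  have h3 : ∀ k, k ^ ((20 + 2 * a) * k) ≤ k ^ (c * k) := by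
    intro k
    obtain rfl | hk := Nat.eq_zero_or_pos k
    · simp
    · exact Nat.pow_le_pow_right hk (Nat.mul_le_mul_right _ (by omega))
  refine ⟨c, fun n k => (h1 n k).trans (Nat.mul_le_mul ?_ ?_)⟩
  · calc a * ((8 * k + 1) ^ (4 * k) * (k + 1) ^ a)
        ≤ a * (9 ^ 4 * 2 ^ a * k ^ ((20 + 2 * a) * k)) := Nat.mul_le_mul_left _ (h2 k)
      _ = a * (9 ^ 4 * 2 ^ a) * k ^ ((20 + 2 * a) * k) := by ring
      _ ≤ c * k ^ (c * k) := Nat.mul_le_mul (by omega) (h3 k)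
  · exact Nat.pow_le_pow_right (by omega) (by omega)

end CliqueId

theorem mainTheorem6 :
    ∃ (p : RAM.Prog) (c : ℕ),
      p.DecidesInTime (fun {n : ℕ} (G : SimpleGraph (Fin n)) (k : ℕ) => CliqueIdentification G k)
        (fun n k => c * k ^ (c * k) * (n + 1) ^ c) := by
  obtain ⟨c, hc⟩ := CliqueId.exists_programCost_le
  refine ⟨CliqueId.program, c, fun n G k => ?_⟩
  obtain ⟨t, s, hx, ht, hs⟩ := CliqueId.wp_program G k
  exact ⟨t, s, hx, ht.trans (hc n k), hs⟩
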